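/- Let $n\ge 0$ and let $V$ be a function from $(0,\infty)$ to the selfadjoint complex $n\times n$ matrices that is $C^\infty$ on $(0,\infty)$ and satisfies, for some $\rho\in(1,2]$ and constants $C_j$, $$\Big\|\frac{d^j}{dx^j}V(x)\Big\|\le C_j(1+x)^{-\rho-j},\qquad x>0,\ j=0,1,2,\dots$$ Let $A,B$ be $n\times n$ matrices with $-B^\dagger A+A^\dagger B=0$ and $A^\dagger A+B^\dagger B>0$. All solutions $\psi$ of $-\psi''+V\psi=k^2\psi$ on $(0,\infty)$ below are $n\times n$ matrix valued, with $\psi,\psi'$ extended continuously to $x=0$. For $k\ne0$, $\operatorname{Im}k\ge0$, let $f(k,\cdot)$ be the Jost solution, i.e. the solution with $f(k,x)=e^{ikx}[I+o(1)]$ and $f'(k,x)=ik\,e^{ikx}[I+o(1)]$ as $x\to+\infty$. For $k\in\mathbf C$ let $\varphi_{A,B}(k,\cdot)$ be the solution with $\varphi_{A,B}(k,0)=A$, $\varphi_{A,B}'(k,0)=B$. For $k\neq 0$, $\operatorname{Im}k\ge0$, let $$J(k)=f(-k^*,x)^\dagger\varphi_{A,B}'(k,x)-f'(-k^*,x)^\dagger\varphi_{A,B}(k,x)$$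 be the Jost matrix. Define on $[0,\infty)$ $$b_0(x)=I,\qquad b_{l+1}(x)=-b_l'(x)-\int_x^\infty V(y)b_l(y)\,dy,$$ put $$c_{-1}=-\tfrac12A,\quad c_0=B-\tfrac12b_1(0)^\dagger A,\quad c_l=b_l(0)^\dagger B-\big(\tfrac12b_{l+1}(0)^\dagger+b_l'(0)^\dagger\big)A\quad(l\ge1),$$ and, for $l\in\mathbf Z$, $$d_l=\sum_{\sigma}\operatorname{sign}\sigma\sum_{l_1,\dots,l_n\ge-1,\ l_1+\dots+l_n=l}(c_{l_1})_{1,\sigma_1}\cdots(c_{l_n})_{n,\sigma_n},$$ where $\sigma$ runs over the permutations of $1,\dots,n$. Then these objects are well defined: the Jost solution and $\varphi_{A,B}$ exist and are unique on $[0,\infty)$, the expression for $J(k)$ does not depend on $x\ge0$, the $b_l$ are $C^\infty$ on $[0,\infty)$, and $Vb_l$ is integrable on $(0,\infty)$. There are $\theta_1,\dots,\theta_n\in(0,\pi]$, a unitary matrix $M$ and invertible matrices $T_1,T_2$ such that $$A=M\tilde A\,T_2M^\dagger T_1,\quad B=M\tilde B\,T_2M^\dagger T_1,\qquad \tilde A=-\operatorname{diag}(\sin\theta_1,\dots,\sin\theta_n),\quad\tilde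 B=\operatorname{diag}(\cos\theta_1,\dots,\cos\theta_n).$$ For every such representation let $n_M$ be the number of $j$ with $\theta_j\ne\pi/2,\pi$ (mixed conditions) and $n_N$ the number of $j$ with $\theta_j=\pi/2$ (Neumann conditions). Then $$\det J(k)\sim\sum_{l=-n_M-n_N}^\infty d_l\,\frac1{(2ik)^l},\qquad k\to\infty\ \text{in}\ \overline{\mathbf C^+},$$ that is, for every integer $N$, $\det J(k)-\sum_{-n_M-n_N\le l\le N}d_l(2ik)^{-l}=O(|k|^{-N-1})$ as $k\to\infty$ in the closed upper half plane. Moreover $d_l=0$ for $l<-n_M-n_N$, and there is a nonzero constant $c_2$ with $$\det J(k)=c_2k^{n_M+n_N}[1+O(1/k)],\quad k\to\infty\ \text{in}\ \overline{\mathbf C^+},\qquad\text{and}\qquad d_{-n_M-n_N}=\frac{c_2}{(2i)^{n_M+n_N}}.$$ -/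

import Mathlib

open scoped Matrix.Norms.L2Operator ComplexConjugate ComplexOrder ContDiff Topology
open Set Filter MeasureTheory Asymptotics

noncomputable section

namespace MatrixSchrodinger

variable {n : ℕ}

/-- The standing conditions on the potential `V`, of which only the values on `(0, ∞)` matter:
it is selfadjoint and `C^∞` on `(0, ∞)`, and there are `ρ ∈ (1, 2]` and constants `C j` with
`‖V⁽ʲ⁾(x)‖ ≤ C j (1 + x)^(-ρ-j)` for all `j` and all `x > 0`. The norm is the operator norm
on `ℂⁿ`. -/
structure IsAdmissiblePotential (V : ℝ → Matrix (Fin n) (Fin n) ℂ) : Prop where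
  selfadjoint : ∀ x : ℝ, 0 < x → (V x).IsHermitian
  smooth : ContDiffOn ℝ ∞ V (Ioi 0)
  decay : ∃ ρ : ℝ, 1 < ρ ∧ ρ ≤ 2 ∧ ∃ C : ℕ → ℝ, ∀ (j : ℕ) (x : ℝ), 0 < x →
    ‖iteratedDeriv j V x‖ ≤ C j * (1 + x) ^ (-ρ - (j : ℝ))

/-- The conditions on the matrices `A, B` in a general selfadjoint boundary condition
`-B† ψ(0) + A† ψ'(0) = 0`. -/
structure IsBoundaryPair (A B : Matrix (Fin n) (Fin n) ℂ) : Prop where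
  symm : -(B.conjTranspose * A) + A.conjTranspose * B = 0
  pos : (A.conjTranspose * A + B.conjTranspose * B).PosDef

/-- The derivative of a function on the half line `[0, ∞)`: the ordinary derivative at `x > 0`
and the right derivative at `x = 0`. -/
def halfDeriv (F : ℝ → Matrix (Fin n) (Fin n) ℂ) : ℝ → Matrix (Fin n) (Fin n) ℂ :=
  derivWithin F (Ici 0)

/-- `ψ` is an `n × n` matrix solution of `-ψ'' + V ψ = k² ψ` on `(0, ∞)`, with `ψ` and `ψ'`
continuous up to `0`. -/
structure IsSolution (V : ℝ → Matrix (Fin n) (Fin n) ℂ) (k : ℂ)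
    (ψ : ℝ → Matrix (Fin n) (Fin n) ℂ) : Prop where
  contDiffOn : ContDiffOn ℝ 1 ψ (Ici 0)
  differentiableAt : ∀ x : ℝ, 0 < x → DifferentiableAt ℝ (halfDeriv ψ) x
  eqn : ∀ x : ℝ, 0 < x → -deriv (halfDeriv ψ) x + V x * ψ x = k ^ 2 • ψ x

/-- `f` is the Jost solution at `k`: `f(x) = e^{ikx} (I + o(1))` and
`f'(x) = ik e^{ikx} (I + o(1))` as `x → +∞`. -/
structure IsJostSolution (V : ℝ → Matrix (Fin n) (Fin n) ℂ) (k : ℂ)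
    (f : ℝ → Matrix (Fin n) (Fin n) ℂ) : Prop where
  isSolution : IsSolution V k f
  tendsto : Tendsto (fun x : ℝ => Complex.exp (-(Complex.I * k * x)) • f x) atTop (𝓝 1)
  tendsto_deriv : Tendsto (fun x : ℝ => Complex.exp (-(Complex.I * k * x)) • halfDeriv f x)
    atTop (𝓝 ((Complex.I * k) • 1))

/-- `φ` is the regular solution at `k`: the solution with `φ(0) = A` and `φ'(0) = B`. -/
structure IsRegularSolution (V : ℝ → Matrix (Fin n) (Fin n) ℂ)
    (A B : Matrix (Fin n) (Fin n) ℂ) (k : ℂ) (φ : ℝ → Matrix (Fin n) (Fin n) ℂ) : Prop where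
  isSolution : IsSolution V k φ
  init : φ 0 = A
  init_deriv : halfDeriv φ 0 = B

/-- The Jost solution `f(k, ·)` (meaningful on `[0, ∞)`). -/
def jostSolution (V : ℝ → Matrix (Fin n) (Fin n) ℂ) (k : ℂ) : ℝ → Matrix (Fin n) (Fin n) ℂ :=
  Classical.epsilon (IsJostSolution V k)

/-- The regular solution `φ_{A,B}(k, ·)` (meaningful on `[0, ∞)`). -/
def regularSolution (V : ℝ → Matrix (Fin n) (Fin n) ℂ) (A B : Matrix (Fin n) (Fin n) ℂ)
    (k : ℂ) : ℝ → Matrix (Fin n) (Fin n) ℂ :=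
  Classical.epsilon (IsRegularSolution V A B k)

/-- The Wronskian `[F; G] = F G' - F' G`. -/
def wronskian (F G : ℝ → Matrix (Fin n) (Fin n) ℂ) (x : ℝ) : Matrix (Fin n) (Fin n) ℂ :=
  F x * halfDeriv G x - halfDeriv F x * G x

/-- The Wronskian `[f(-k*, x)†; φ_{A,B}(k, x)]`, which does not depend on `x`. -/
def jostWronskian (V : ℝ → Matrix (Fin n) (Fin n) ℂ) (A B : Matrix (Fin n) (Fin n) ℂ)
    (k : ℂ) (x : ℝ) : Matrix (Fin n) (Fin n) ℂ :=
  wronskian (fun y => (jostSolution V (-conj k) y).conjTranspose) (regularSolution V A B k) x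

/-- The Jost matrix `J(k) = [f(-k*, x)†; φ_{A,B}(k, x)]`, evaluated at `x = 0`. -/
def jostMatrix (V : ℝ → Matrix (Fin n) (Fin n) ℂ) (A B : Matrix (Fin n) (Fin n) ℂ)
    (k : ℂ) : Matrix (Fin n) (Fin n) ℂ :=
  jostWronskian V A B k 0

/-- The functions `b_l` on `[0, ∞)`: `b_0 = I` and `b_{l+1}(x) = -b_l'(x) - ∫_x^∞ V b_l`. -/
def bCoeff (V : ℝ → Matrix (Fin n) (Fin n) ℂ) : ℕ → ℝ → Matrix (Fin n) (Fin n) ℂ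
  | 0 => fun _ => 1
  | l + 1 => fun x => -halfDeriv (bCoeff V l) x - ∫ y in Ioi x, V y * bCoeff V l y

/-- The coefficients `c_l`, `l ≥ -1` (and `0` for `l ≤ -2`), of the expansion of `J(k)`. -/
def cCoeff (V : ℝ → Matrix (Fin n) (Fin n) ℂ) (A B : Matrix (Fin n) (Fin n) ℂ) :
    ℤ → Matrix (Fin n) (Fin n) ℂ
  | .negSucc 0 => -((1 / 2 : ℂ) • A)
  | .ofNat 0 => B - (1 / 2 : ℂ) • ((bCoeff V 1 0).conjTranspose * A)
  | .ofNat (l + 1) => (bCoeff V (l + 1) 0).conjTranspose * B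
      - ((1 / 2 : ℂ) • (bCoeff V (l + 2) 0).conjTranspose
          + (halfDeriv (bCoeff V (l + 1)) 0).conjTranspose) * A
  | .negSucc (_ + 1) => 0

/-- The index tuples `(l_1, …, l_n)` of integers with all `l_i ≥ -1` and `l_1 + ⋯ + l_n = l`
(every such `l_i` is at most `l + n - 1`). -/
def indexTuples (n : ℕ) (l : ℤ) : Finset (Fin n → ℤ) :=
  (Fintype.piFinset fun _ : Fin n => Finset.Icc (-1 : ℤ) (l + n - 1)).filter
    fun t => ∑ i, t i = l

theorem mem_indexTuples (n : ℕ) (l : ℤ) (t : Fin n → ℤ) :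
    t ∈ indexTuples n l ↔ (∀ i, -1 ≤ t i) ∧ ∑ i, t i = l := by
  unfold indexTuples
  simp only [Finset.mem_filter, Fintype.mem_piFinset, Finset.mem_Icc]
  refine ⟨fun h => ⟨fun i => (h.1 i).1, h.2⟩, fun h => ⟨fun i => ⟨h.1 i, ?_⟩, h.2⟩⟩
  have h1 : ∑ j ∈ Finset.univ.erase i, (-1 : ℤ) ≤ ∑ j ∈ Finset.univ.erase i, t j :=
    Finset.sum_le_sum fun j _ => h.1 j
  have h2 := Finset.add_sum_erase Finset.univ t (Finset.mem_univ i)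
  rw [h.2] at h2
  have h3 : 0 < n := i.pos
  rw [Finset.sum_const, Finset.card_erase_of_mem (Finset.mem_univ i), Finset.card_univ,
    Fintype.card_fin, nsmul_eq_mul] at h1
  push_cast [Nat.cast_sub (show 1 ≤ n from h3)] at h1
  linarith

/-- The coefficients `d_l` of the expansion of `det J(k)`. -/
def dCoeff (V : ℝ → Matrix (Fin n) (Fin n) ℂ) (A B : Matrix (Fin n) (Fin n) ℂ) (l : ℤ) : ℂ :=
  ∑ σ : Equiv.Perm (Fin n), ((Equiv.Perm.sign σ : ℤ) : ℂ) *
    ∑ t ∈ indexTuples n l, ∏ i, cCoeff V A B (t i) i (σ i)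

/-- `Ã = -diag(sin θ_1, …, sin θ_n)`. -/
def diagA (θ : Fin n → ℝ) : Matrix (Fin n) (Fin n) ℂ :=
  -Matrix.diagonal fun j => (Real.sin (θ j) : ℂ)

/-- `B̃ = diag(cos θ_1, …, cos θ_n)`. -/
def diagB (θ : Fin n → ℝ) : Matrix (Fin n) (Fin n) ℂ :=
  Matrix.diagonal fun j => (Real.cos (θ j) : ℂ)

/-- `A = M Ã T₂ M† T₁` and `B = M B̃ T₂ M† T₁` with `θ_j ∈ (0, π]`, `M` unitary and `T₁, T₂`
invertible. -/
structure IsDiagonalRepresentation (A B : Matrix (Fin n) (Fin n) ℂ) (θ : Fin n → ℝ)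
    (M T₁ T₂ : Matrix (Fin n) (Fin n) ℂ) : Prop where
  angles : ∀ j, θ j ∈ Ioc 0 Real.pi
  unitary : M ∈ Matrix.unitaryGroup (Fin n) ℂ
  isUnit₁ : IsUnit T₁
  isUnit₂ : IsUnit T₂
  eqA : A = M * diagA θ * T₂ * M.conjTranspose * T₁
  eqB : B = M * diagB θ * T₂ * M.conjTranspose * T₁

/-- The number of mixed conditions, `θ_j ≠ π/2, π`. -/
def numMixed (θ : Fin n → ℝ) : ℕ :=
  (Finset.univ.filter fun j => θ j ≠ Real.pi / 2 ∧ θ j ≠ Real.pi).card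

/-- The number of Neumann conditions, `θ_j = π/2`. -/
def numNeumann (θ : Fin n → ℝ) : ℕ :=
  (Finset.univ.filter fun j => θ j = Real.pi / 2).card

/-- `k → ∞` in the closed upper half plane. -/
def atInftyUpper : Filter ℂ :=
  Bornology.cobounded ℂ ⊓ 𝓟 {k : ℂ | 0 ≤ k.im}

end MatrixSchrodinger

end

open MatrixSchrodinger

/-!
Write `z = 2ik`, so that `Re z ≤ 0` in the closed upper half plane, and let `u = e^{-ikx} f(k, x)`
be the normalized Jost solution. It solves `u'' + z u' = V u` with `u → 1` and `u' → 0` at infinity,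
and is the only solution of the Volterra equation
`u(x) = 1 + z⁻¹ ∫_x^∞ (e^{z(y-x)} - 1) V(y) u(y) dy`, which is a contraction in a suitable weighted
sup norm (`exists_isNormalizedJost`). The regular solution is treated in the same way, and the
Wronskian is constant because its derivative vanishes.

All derivatives of `V` are bounded near `0`, so `V` extends smoothly to `[0, ∞)`
(`exists_smoothDecay_extension`), and an induction shows that the `b_l` are smooth and bounded with
integrable derivatives (`IsExpansionCoeff.smoothDecay`). The recursion for `b_l` is made so that
the partial sum `∑_{l ≤ L} b_l z⁻ˡ` solves the equation for `u` up to the integrable term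
`z⁻ᴸ b_{L+1}'`. The difference to `u` then obeys the same Volterra equation with a small
inhomogeneity and is `O(|k|^{-L-1})` (`norm_le_of_inhomogeneous`,
`IsExpansionCoeff.norm_jost_sub_le`). Taking adjoints at `x = 0` gives
`J(k) ~ ∑_{l ≥ -1} c_l z⁻ˡ` (`isBigO_jostMatrix_sub`), and multiplying out the Leibniz formula gives
an expansion of `det J(k)` in the powers `zⁿ, zⁿ⁻¹, …` (`isBigO_det_jostMatrix_sub`).

For the leading term, insert the diagonal representation: up to the invertible right factor
`T₂ M† T₁`, the `j`-th column of `J(k)` is `-(M e_j + O(1/k))` for a Dirichlet condition and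
`ik sin θ_j (M e_j + O(1/k))` otherwise, so `det J(k) = c₂ k^p (1 + O(1/k))` with `p = n_M + n_N`
and `c₂ ≠ 0` (`exists_det_jostMatrix_leading`). Coefficients of an asymptotic expansion are unique,
hence `d_l = 0` for `l < -p` and `d_{-p} (2i)^p = c₂`.

A diagonal representation exists because `B + tA` is invertible for some real `t`, and
`A (B + tA)⁻¹` is Hermitian (`IsBoundaryPair.exists_isDiagonalRepresentation`).
-/

namespace MatrixSchrodinger

/-! ### Smooth functions on the half line with decaying derivatives -/

section HalfLine

variable {E : Type*} [NormedAddCommGroup E] [NormedSpace ℝ E]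

theorem exists_tendsto_nhdsGT_zero [CompleteSpace E] {g g' : ℝ → E} {C : ℝ}
    (hg : ∀ x, 0 < x → HasDerivAt g (g' x) x) (hC : ∀ x, 0 < x → ‖g' x‖ ≤ C) :
    ∃ L, Tendsto g (𝓝[>] 0) (𝓝 L) := by
  have hlip : LipschitzOnWith C.toNNReal g (Ioi 0) :=
    (convex_Ioi (0 : ℝ)).lipschitzOnWith_of_nnnorm_hasDerivWithin_le
      (fun x hx => (hg x hx).hasDerivWithinAt) fun x hx => by
        rw [← NNReal.coe_le_coe, coe_nnnorm]
        exact (hC x hx).trans (Real.le_coe_toNNReal C)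
  refine cauchy_map_iff_exists_tendsto.1 ?_
  exact (cauchy_nhds.mono nhdsWithin_le_nhds : Cauchy (𝓝[>] (0 : ℝ))).map_of_le
    hlip.uniformContinuousOn inf_le_right

/-- A function on `[0, ∞)` that starts an infinite chain of derivatives is smooth, and the chain
lists its iterated derivatives. -/
theorem contDiffOn_of_chain {g : ℕ → ℝ → E}
    (hg : ∀ j x, 0 ≤ x → HasDerivWithinAt (g j) (g (j + 1) x) (Ici 0) x) :
    ContDiffOn ℝ ∞ (g 0) (Ici 0) ∧
      ∀ j x, 0 ≤ x → iteratedDerivWithin j (g 0) (Ici 0) x = g j x := by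
  have h : ∀ j x, 0 ≤ x → iteratedDerivWithin j (g 0) (Ici 0) x = g j x := by
    intro j
    induction j with
    | zero => intro x _; rw [iteratedDerivWithin_zero]
    | succ j ih =>
      intro x hx
      rw [iteratedDerivWithin_succ,
        derivWithin_congr (s := Ici 0) (fun y hy => ih y hy) (ih x hx)]
      exact (hg j x hx).derivWithin (uniqueDiffOn_Ici 0 x hx)
  refine ⟨contDiffOn_of_differentiableOn_deriv (n := ⊤) fun m _ => ?_, h⟩
  exact DifferentiableOn.congr (fun x hx => (hg m x hx).differentiableWithinAt) fun x hx => h m x hx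

/-- `G` is smooth on `[0, ∞)` and each of its derivatives, of order `0` included, is
`O((1 + x)^(-r))`. For `r = 0` this says that all derivatives are bounded. -/
structure SmoothDecay (r : ℝ) (G : ℝ → E) : Prop where
  smooth : ContDiffOn ℝ ∞ G (Ici 0)
  bound : ∀ j : ℕ, ∃ C : ℝ, ∀ x, 0 ≤ x →
    ‖iteratedDerivWithin j G (Ici 0) x‖ ≤ C * (1 + x) ^ (-r)

namespace SmoothDecay

variable {r s : ℝ} {F G : ℝ → E}

theorem congr (hG : SmoothDecay r G) (h : EqOn F G (Ici 0)) : SmoothDecay r F :=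
  ⟨hG.smooth.congr h, fun j => by
    obtain ⟨C, hC⟩ := hG.bound j
    exact ⟨C, fun x hx => by rw [iteratedDerivWithin_congr h hx]; exact hC x hx⟩⟩

theorem exists_norm_le (hG : SmoothDecay r G) :
    ∃ C, 0 < C ∧ ∀ x, 0 ≤ x → ‖G x‖ ≤ C * (1 + x) ^ (-r) := by
  obtain ⟨C, hC⟩ := hG.bound 0
  refine ⟨max C 1, by positivity, fun x hx => ?_⟩
  have := hC x hx
  rw [iteratedDerivWithin_zero] at this
  exact this.trans (mul_le_mul_of_nonneg_right (le_max_left _ _) (by positivity))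

theorem mono (hG : SmoothDecay r G) (h : s ≤ r) : SmoothDecay s G :=
  ⟨hG.smooth, fun j => by
    obtain ⟨C, hC⟩ := hG.bound j
    refine ⟨max C 0, fun x hx => (hC x hx).trans ?_⟩
    have := Real.rpow_le_rpow_of_exponent_le (x := 1 + x) (by linarith) (neg_le_neg h)
    have h0 : 0 ≤ (1 + x) ^ (-r) := by positivity
    calc C * (1 + x) ^ (-r) ≤ max C 0 * (1 + x) ^ (-r) := by gcongr; exact le_max_left _ _
      _ ≤ _ := by gcongr⟩

theorem continuousOn (hG : SmoothDecay r G) : ContinuousOn G (Ici 0) := hG.smooth.continuousOn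

theorem hasDerivWithinAt (hG : SmoothDecay r G) {x : ℝ} (hx : 0 ≤ x) :
    HasDerivWithinAt G (derivWithin G (Ici 0) x) (Ici 0) x :=
  ((hG.smooth.differentiableOn (by simp)) x hx).hasDerivWithinAt

theorem derivWithin (hG : SmoothDecay r G) : SmoothDecay r (derivWithin G (Ici 0)) :=
  ⟨((contDiffOn_infty_iff_derivWithin (uniqueDiffOn_Ici 0)).1 hG.smooth).2, fun j => by
    obtain ⟨C, hC⟩ := hG.bound (j + 1)
    exact ⟨C, fun x hx => by rw [← iteratedDerivWithin_succ']; exact hC x hx⟩⟩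

theorem of_derivWithin {C : ℝ} (hd : DifferentiableOn ℝ G (Ici 0))
    (hC : ∀ x, 0 ≤ x → ‖G x‖ ≤ C * (1 + x) ^ (-r))
    (hG : SmoothDecay r (_root_.derivWithin G (Ici 0))) : SmoothDecay r G :=
  ⟨(contDiffOn_infty_iff_derivWithin (uniqueDiffOn_Ici 0)).2 ⟨hd, hG.smooth⟩, fun j => by
    cases j with
    | zero => exact ⟨C, fun x hx => by rw [iteratedDerivWithin_zero]; exact hC x hx⟩
    | succ j =>
      obtain ⟨C, hC⟩ := hG.bound j
      exact ⟨C, fun x hx => by rw [iteratedDerivWithin_succ']; exact hC x hx⟩⟩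

theorem add (hF : SmoothDecay r F) (hG : SmoothDecay r G) :
    SmoothDecay r (fun x => F x + G x) :=
  ⟨hF.smooth.add hG.smooth, fun j => by
    obtain ⟨C, hC⟩ := hF.bound j
    obtain ⟨D, hD⟩ := hG.bound j
    refine ⟨C + D, fun x hx => ?_⟩
    have h1 : ContDiffWithinAt ℝ j F (Ici 0) x := (hF.smooth x hx).of_le (by exact_mod_cast le_top)
    have h2 : ContDiffWithinAt ℝ j G (Ici 0) x := (hG.smooth x hx).of_le (by exact_mod_cast le_top)
    rw [iteratedDerivWithin_fun_add (mem_Ici.2 hx) (uniqueDiffOn_Ici 0) h1 h2, add_mul]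
    exact (norm_add_le _ _).trans (add_le_add (hC x hx) (hD x hx))⟩

theorem neg (hG : SmoothDecay r G) : SmoothDecay r (fun x => -G x) :=
  ⟨hG.smooth.neg, fun j => by
    obtain ⟨C, hC⟩ := hG.bound j
    refine ⟨C, fun x hx => ?_⟩
    rw [iteratedDerivWithin_fun_neg, norm_neg]
    exact hC x hx⟩

theorem const (c : E) : SmoothDecay 0 (fun _ : ℝ => c) :=
  ⟨contDiffOn_const, fun j => ⟨‖c‖, fun x _ => by
    rw [iteratedDerivWithin_const]
    split_ifs <;> simp⟩⟩

theorem mul {E : Type*} [NormedRing E] [NormedAlgebra ℝ E] {F G : ℝ → E}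
    (hF : SmoothDecay r F) (hG : SmoothDecay s G) : SmoothDecay (r + s) (fun x => F x * G x) :=
  ⟨hF.smooth.mul hG.smooth, fun j => by
    choose C hC using hF.bound
    choose D hD using hG.bound
    refine ⟨∑ i ∈ Finset.range (j + 1), (j.choose i : ℝ) * (C i) * D (j - i), fun x hx => ?_⟩
    have h := norm_iteratedFDerivWithin_mul_le hF.smooth hG.smooth (uniqueDiffOn_Ici 0)
      (mem_Ici.2 hx) (n := j) (by exact_mod_cast le_top)
    simp only [norm_iteratedFDerivWithin_eq_norm_iteratedDerivWithin] at h
    refine h.trans ?_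
    rw [Finset.sum_mul]
    refine Finset.sum_le_sum fun i _ => ?_
    rw [neg_add, Real.rpow_add (by linarith)]
    calc _ ≤ (j.choose i : ℝ) * (C i * (1 + x) ^ (-r)) * (D (j - i) * (1 + x) ^ (-s)) := by
          have := hC i x hx
          have := hD (j - i) x hx
          gcongr
          exact mul_nonneg (by positivity) ((norm_nonneg _).trans (hC i x hx))
      _ = _ := by ring⟩

theorem integrableOn (hr : 1 < r) (hG : SmoothDecay r G) : IntegrableOn G (Ioi 0) := by
  obtain ⟨C, -, hC⟩ := hG.exists_norm_le
  have h := (integrableOn_add_rpow_Ioi_of_lt (a := -r) (c := 0) (m := 1) (by linarith)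
    (by norm_num)).const_mul C
  refine Integrable.mono' h
    ((hG.continuousOn.mono Ioi_subset_Ici_self).aestronglyMeasurable measurableSet_Ioi) ?_
  refine (ae_restrict_mem measurableSet_Ioi).mono fun x hx => ?_
  rw [add_comm x 1]
  exact hC x (le_of_lt hx)

end SmoothDecay

theorem hasDerivAt_iteratedDeriv_of_contDiffOn_Ioi {V : ℝ → E} (hV : ContDiffOn ℝ ∞ V (Ioi 0))
    (j : ℕ) {x : ℝ} (hx : 0 < x) :
    HasDerivAt (iteratedDeriv j V) (iteratedDeriv (j + 1) V x) x := by
  have h := hV.differentiableOn_iteratedDerivWithin (m := j)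
    (by exact_mod_cast ENat.natCast_lt_top j) (uniqueDiffOn_Ioi 0)
  have h2 : DifferentiableOn ℝ (iteratedDeriv j V) (Ioi 0) :=
    h.congr fun y hy => (iteratedDerivWithin_of_isOpen isOpen_Ioi hy).symm
  rw [iteratedDeriv_succ]
  exact (h2.differentiableAt (Ioi_mem_nhds hx)).hasDerivAt

/-- A smooth function on `(0, ∞)` with decaying derivatives extends smoothly to `[0, ∞)`: each
derivative is Lipschitz near `0`, so it has a limit there. -/
theorem exists_smoothDecay_extension [CompleteSpace E] {V : ℝ → E} {r : ℝ} (hr : 0 ≤ r)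
    (hV : ContDiffOn ℝ ∞ V (Ioi 0)) {C : ℕ → ℝ}
    (hC : ∀ j x, 0 < x → ‖iteratedDeriv j V x‖ ≤ C j * (1 + x) ^ (-r)) :
    ∃ W : ℝ → E, SmoothDecay r W ∧ ∀ x, 0 < x → W x = V x := by
  have hC0 : ∀ j, 0 ≤ C j := fun j =>
    nonneg_of_mul_nonneg_left ((norm_nonneg _).trans (hC j 1 one_pos)) (by positivity)
  have hd := fun j x hx => hasDerivAt_iteratedDeriv_of_contDiffOn_Ioi hV j (x := x) hx
  have hlim : ∀ j, ∃ L, Tendsto (iteratedDeriv j V) (𝓝[>] 0) (𝓝 L) := fun j =>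
    exists_tendsto_nhdsGT_zero (hd j) (C := C (j + 1)) fun x hx => (hC _ x hx).trans
      (mul_le_of_le_one_right (hC0 _)
        (Real.rpow_le_one_of_one_le_of_nonpos (by linarith) (by linarith)))
  choose l hl using hlim
  -- the derivatives of `V`, extended to `0` by their limits, form a chain of derivatives
  let g : ℕ → ℝ → E := fun j x => if 0 < x then iteratedDeriv j V x else l j
  have hg : ∀ j x, 0 < x → g j x = iteratedDeriv j V x := fun j x hx => if_pos hx
  have hg0 : ∀ j, g j 0 = l j := fun j => if_neg (lt_irrefl _)
  have hgd : ∀ j x, 0 < x → HasDerivAt (g j) (g (j + 1) x) x := fun j x hx => by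
    rw [hg _ x hx]
    exact (hd j x hx).congr_of_eventuallyEq ((eventually_gt_nhds hx).mono fun y hy => hg j y hy)
  have hgl : ∀ j, Tendsto (g j) (𝓝[>] 0) (𝓝 (l j)) := fun j =>
    (hl j).congr' (eventually_mem_nhdsWithin.mono fun y hy => (hg j y hy).symm)
  have hchain : ∀ j x, 0 ≤ x → HasDerivWithinAt (g j) (g (j + 1) x) (Ici 0) x := by
    intro j x hx
    rcases hx.eq_or_lt with rfl | hx
    · rw [hg0]
      refine hasDerivWithinAt_Ici_of_tendsto_deriv (s := Ioi 0)
        (fun y hy => (hgd j y hy).differentiableAt.differentiableWithinAt) ?_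
        self_mem_nhdsWithin ?_
      · rw [ContinuousWithinAt, hg0]
        exact hgl j
      · exact (hgl (j + 1)).congr'
          (eventually_mem_nhdsWithin.mono fun y hy => (hgd j y hy).deriv.symm)
    · exact (hgd j x hx).hasDerivWithinAt
  obtain ⟨h1, h2⟩ := contDiffOn_of_chain hchain
  refine ⟨g 0, ⟨h1, fun j => ⟨C j, fun x hx => ?_⟩⟩,
    fun x hx => by rw [hg 0 x hx, iteratedDeriv_zero]⟩
  rw [h2 j x hx]
  rcases hx.eq_or_lt with rfl | hx
  · rw [hg0]
    have hc : ContinuousAt (fun x : ℝ => C j * (1 + x) ^ (-r)) 0 := by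
      refine continuousAt_const.mul (ContinuousAt.rpow_const (by fun_prop) (Or.inl (by norm_num)))
    exact le_of_tendsto_of_tendsto (hl j).norm (hc.tendsto.mono_left nhdsWithin_le_nhds)
      (eventually_mem_nhdsWithin.mono fun y hy => hC j y hy)
  · rw [hg j x hx]
    exact hC j x hx

end HalfLine

/-! ### Tail integrals -/

section Tail

variable {E : Type*} [NormedAddCommGroup E]

theorem integrableOn_Ioi_of_continuous {h : ℝ → E} (hc : Continuous h)
    (hi : IntegrableOn h (Ioi 0)) (a : ℝ) : IntegrableOn h (Ioi a) := by
  refine ((hc.integrableOn_Icc (a := a) (b := 0)).union hi).mono_set fun x hx => ?_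
  rcases le_or_gt x 0 with h0 | h0
  · exact Or.inl ⟨le_of_lt hx, h0⟩
  · exact Or.inr h0

theorem hasDerivAt_tail [NormedSpace ℝ E] [CompleteSpace E] {h : ℝ → E} (hc : Continuous h)
    (hi : IntegrableOn h (Ioi 0)) (x : ℝ) :
    HasDerivAt (fun x => ∫ y in Ioi x, h y) (-h x) x := by
  have hi' := integrableOn_Ioi_of_continuous hc hi
  have heq : (fun x => ∫ y in Ioi x, h y) =
      fun x => (∫ y in Ioi 0, h y) - ∫ y in (0:ℝ)..x, h y := by
    funext z
    rw [← intervalIntegral.integral_Ioi_sub_Ioi' (hi' 0) (hi' z), sub_sub_cancel]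
  rw [heq]
  exact (intervalIntegral.integral_hasDerivAt_right (hc.intervalIntegrable _ _)
    (hc.stronglyMeasurableAtFilter _ _) hc.continuousAt).const_sub _

theorem tendsto_tail [NormedSpace ℝ E] {h : ℝ → E} (hi : IntegrableOn h (Ioi 0)) :
    Tendsto (fun x => ∫ y in Ioi x, h y) atTop (𝓝 0) := by
  have h1 := (intervalIntegral_tendsto_integral_Ioi 0 hi tendsto_id).const_sub (∫ y in Ioi 0, h y)
  rw [sub_self] at h1
  refine h1.congr' ((eventually_ge_atTop 0).mono fun z hz => ?_)
  rw [id, ← intervalIntegral.integral_Ioi_sub_Ioi hi hz, sub_sub_cancel]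

theorem continuous_comp_max {G : ℝ → E} (hG : ContinuousOn G (Ici 0)) :
    Continuous fun x => G (max x 0) :=
  hG.comp_continuous (by fun_prop) fun x => le_max_right x 0

theorem hasDerivWithinAt_tail [NormedSpace ℝ E] [CompleteSpace E] {h : ℝ → E}
    (hc : ContinuousOn h (Ici 0)) (hi : IntegrableOn h (Ioi 0)) {x : ℝ} (hx : 0 ≤ x) :
    HasDerivWithinAt (fun x => ∫ y in Ioi x, h y) (-h x) (Ici 0) x := by
  have heq : ∀ a, 0 ≤ a → EqOn (fun y => h (max y 0)) h (Ioi a) := fun a ha y hy => by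
    simp only [max_eq_left (ha.trans (le_of_lt hy))]
  have hi' : IntegrableOn (fun y => h (max y 0)) (Ioi 0) :=
    hi.congr_fun (heq 0 le_rfl).symm measurableSet_Ioi
  have h1 := (hasDerivAt_tail (continuous_comp_max hc) hi' x).hasDerivWithinAt (s := Ici 0)
  simp only [max_eq_left hx] at h1
  exact h1.congr (fun z hz => (setIntegral_congr_fun measurableSet_Ioi (heq z hz)).symm)
    (setIntegral_congr_fun measurableSet_Ioi (heq x hx)).symm

theorem SmoothDecay.tail [NormedSpace ℝ E] [CompleteSpace E] {h : ℝ → E} {r : ℝ} (hr : 1 < r)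
    (hh : SmoothDecay r h) : SmoothDecay 0 (fun x => ∫ y in Ioi x, h y) := by
  have hi := hh.integrableOn hr
  have hd := fun x (hx : 0 ≤ x) => hasDerivWithinAt_tail hh.continuousOn hi hx
  refine .of_derivWithin (C := ∫ y in Ioi 0, ‖h y‖)
    (fun x hx => (hd x hx).differentiableWithinAt) (fun x hx => ?_) ?_
  · rw [neg_zero, Real.rpow_zero, mul_one]
    exact (norm_integral_le_integral_norm _).trans (setIntegral_mono_set hi.norm
      (ae_of_all _ fun _ => norm_nonneg _) (Ioi_subset_Ioi hx).eventuallyLE)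
  · exact (hh.neg.mono (by linarith)).congr fun x hx =>
      (hd x hx).derivWithin (uniqueDiffOn_Ici 0 x hx)

end Tail

/-! ### Volterra equations and the regular solution -/

section FixedPoint

variable {E : Type*} [NormedAddCommGroup E] [NormedSpace ℝ E] [CompleteSpace E]

/-- A map that halves distances measured relative to a weight `κ` has exactly one fixed point
among the continuous functions that are `O(κ)`. -/
theorem existsUnique_fixedPoint_of_weight {κ : ℝ → ℝ} (hκ : Continuous κ) (hpos : ∀ x, 0 < κ x)
    {T : (ℝ → E) → ℝ → E}
    (hTc : ∀ u, Continuous u → (∃ C, ∀ x, ‖u x‖ ≤ C * κ x) → Continuous (T u))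
    (hT0 : ∃ C, ∀ x, ‖T 0 x‖ ≤ C * κ x)
    (hT : ∀ u v, Continuous u → Continuous v → (∃ C, ∀ x, ‖u x‖ ≤ C * κ x) →
      (∃ C, ∀ x, ‖v x‖ ≤ C * κ x) → ∀ D, 0 ≤ D → (∀ x, ‖u x - v x‖ ≤ D * κ x) →
      ∀ x, ‖T u x - T v x‖ ≤ D / 2 * κ x) :
    ∃! u, (Continuous u ∧ ∃ C, ∀ x, ‖u x‖ ≤ C * κ x) ∧ T u = u := by
  have hTb : ∀ u, Continuous u → (∃ C, ∀ x, ‖u x‖ ≤ C * κ x) → ∃ C, ∀ x, ‖T u x‖ ≤ C * κ x := by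
    rintro u hu ⟨C, hC⟩
    obtain ⟨C0, hC0⟩ := hT0
    refine ⟨max C 0 / 2 + C0, fun x => ?_⟩
    have h1 := hT u 0 hu continuous_const ⟨C, hC⟩ ⟨0, fun x => by simp⟩ (max C 0)
      (le_max_right _ _) (fun x => by
        rw [Pi.zero_apply, sub_zero]
        exact (hC x).trans (mul_le_mul_of_nonneg_right (le_max_left _ _) (hpos x).le)) x
    have h2 := norm_add_le (T u x - T 0 x) (T 0 x)
    rw [sub_add_cancel] at h2
    linarith [hC0 x]
  -- the map is conjugated by the weight to a contraction of the space of bounded functions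
  let unweight : BoundedContinuousFunction ℝ E → ℝ → E := fun w x => κ x • w x
  have hu_c : ∀ w, Continuous (unweight w) := fun w => hκ.smul w.continuous
  have hu_b : ∀ w, ∃ C, ∀ x, ‖unweight w x‖ ≤ C * κ x := fun w => ⟨‖w‖, fun x => by
    rw [norm_smul, Real.norm_of_nonneg (hpos x).le, mul_comm]
    exact mul_le_mul_of_nonneg_right (w.norm_coe_le_norm x) (hpos x).le⟩
  have weight : ∀ u : ℝ → E, Continuous u → (∃ C, ∀ x, ‖u x‖ ≤ C * κ x) →
      ∃ w : BoundedContinuousFunction ℝ E, ∀ x, w x = (κ x)⁻¹ • u x := by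
    rintro u hu ⟨C, hC⟩
    refine ⟨BoundedContinuousFunction.ofNormedAddCommGroup (fun x => (κ x)⁻¹ • u x)
      ((hκ.inv₀ fun x => (hpos x).ne').smul hu) C fun x => ?_, fun x => rfl⟩
    rw [norm_smul, norm_inv, Real.norm_of_nonneg (hpos x).le, inv_mul_le_iff₀ (hpos x), mul_comm]
    exact hC x
  choose Φ hΦ using fun w => weight (T (unweight w)) (hTc _ (hu_c w) (hu_b w))
    (hTb _ (hu_c w) (hu_b w))
  have hcontr : ContractingWith (1 / 2) Φ := by
    refine ⟨by rw [← NNReal.coe_lt_coe]; norm_num, LipschitzWith.of_dist_le_mul fun w₁ w₂ => ?_⟩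
    refine (BoundedContinuousFunction.dist_le (by positivity)).2 fun x => ?_
    have h1 := hT _ _ (hu_c w₁) (hu_c w₂) (hu_b w₁) (hu_b w₂) (dist w₁ w₂) dist_nonneg
      (fun x => by
        simp only [unweight]
        rw [← smul_sub, norm_smul, Real.norm_of_nonneg (hpos x).le, mul_comm, ← dist_eq_norm]
        exact mul_le_mul_of_nonneg_right (BoundedContinuousFunction.dist_coe_le_dist x)
          (hpos x).le) x
    rw [hΦ, hΦ, dist_eq_norm, ← smul_sub, norm_smul, norm_inv, Real.norm_of_nonneg (hpos x).le,
      inv_mul_le_iff₀ (hpos x)]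
    refine h1.trans (le_of_eq ?_)
    push_cast
    ring
  refine ⟨unweight (ContractingWith.fixedPoint Φ hcontr), ⟨⟨hu_c _, hu_b _⟩, ?_⟩, ?_⟩
  · funext x
    have h := DFunLike.congr_fun hcontr.fixedPoint_isFixedPt x
    rw [hΦ, inv_smul_eq_iff₀ (hpos x).ne'] at h
    exact h
  · rintro v ⟨⟨hvc, hvb⟩, hv⟩
    obtain ⟨w, hw⟩ := weight v hvc hvb
    have hwv : unweight w = v := funext fun x => by
      simp only [unweight, hw, smul_inv_smul₀ (hpos x).ne']
    have hfix : Φ w = w := by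
      ext x
      rw [hΦ, hwv, hv, hw]
    rw [← hwv, hcontr.fixedPoint_unique hfix]

end FixedPoint

section LinearSystem

variable {E : Type*} [NormedRing E] [NormedAlgebra ℝ E]

/-- Existence for the second order linear equation `ψ'' = G ψ` on `[0, ∞)` with bounded continuous
coefficient, as a fixed point for the weight `e^{λx}`. -/
theorem exists_linear_second_order [CompleteSpace E] {G : ℝ → E} (hG : ContinuousOn G (Ici 0))
    {K : ℝ} (hK : ∀ x, 0 ≤ x → ‖G x‖ ≤ K) (a b : E) :
    ∃ ψ χ : ℝ → E, ψ 0 = a ∧ χ 0 = b ∧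
      (∀ x, 0 ≤ x → HasDerivWithinAt ψ (χ x) (Ici 0) x) ∧
      ∀ x, 0 ≤ x → HasDerivWithinAt χ (G x * ψ x) (Ici 0) x := by
  let H : ℝ → E := fun x => G (max x 0)
  have hH : Continuous H := continuous_comp_max hG
  let M : ℝ := max K 1
  have hM : 0 < M := by positivity
  have hHM : ∀ x, ‖H x‖ ≤ M := fun x => (hK _ (le_max_right x 0)).trans (le_max_left _ _)
  let F : (ℝ → E × E) → ℝ → E × E := fun Y y => ((Y y).2, H y * (Y y).1)
  have hF : ∀ Y, Continuous Y → Continuous (F Y) := fun Y hY =>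
    hY.snd.prodMk (hH.mul hY.fst)
  let T : (ℝ → E × E) → ℝ → E × E := fun Y x => (a, b) + ∫ y in (0:ℝ)..(max x 0), F Y y
  have hd : ∀ Y, Continuous Y → ∀ x, HasDerivAt (fun x => ∫ y in (0:ℝ)..x, F Y y) (F Y x) x :=
    fun Y hY x => intervalIntegral.integral_hasDerivAt_right ((hF Y hY).intervalIntegrable _ _)
      ((hF Y hY).stronglyMeasurableAtFilter _ _) (hF Y hY).continuousAt
  have hc : ∀ Y, Continuous Y → Continuous fun x => ∫ y in (0:ℝ)..x, F Y y := fun Y hY =>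
    continuous_iff_continuousAt.2 fun x => (hd Y hY x).continuousAt
  -- `λ = 2M` makes the map a contraction by `1/2`; outside `[0, ∞)` everything is constant
  let κ : ℝ → ℝ := fun x => Real.exp (2 * M * max x 0)
  obtain ⟨Y, ⟨⟨hYc, -⟩, hY⟩, -⟩ := existsUnique_fixedPoint_of_weight (E := E × E) (κ := κ) (T := T)
    (by fun_prop) (fun x => Real.exp_pos _)
    (fun Y hY _ => continuous_const.add ((hc Y hY).comp (by fun_prop)))
    ⟨‖(a, b)‖, fun x => by
      have : F 0 = 0 := by funext y; simp [F]
      simp only [T, this, Pi.zero_apply, intervalIntegral.integral_zero, add_zero]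
      exact le_mul_of_one_le_right (norm_nonneg _) (Real.one_le_exp (by positivity))⟩
    (fun Y Z hY hZ _ _ D hD hYZ x => by
      have hx : 0 ≤ max x 0 := le_max_right _ _
      change ‖((a, b) + ∫ y in (0:ℝ)..(max x 0), F Y y) - ((a, b) + ∫ y in (0:ℝ)..(max x 0), F Z y)‖
        ≤ D / 2 * Real.exp (2 * M * max x 0)
      generalize max x 0 = X at hx
      rw [add_sub_add_left_eq_sub, ← intervalIntegral.integral_sub
        ((hF Y hY).intervalIntegrable _ _) ((hF Z hZ).intervalIntegrable _ _)]
      have hint : ∫ y in (0:ℝ)..X, M * D * Real.exp (2 * M * y)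
          = D / 2 * Real.exp (2 * M * X) - D / 2 * Real.exp (2 * M * 0) := by
        refine intervalIntegral.integral_eq_sub_of_hasDerivAt
          (f := fun y => D / 2 * Real.exp (2 * M * y))
          (fun y _ => ?_) (Continuous.intervalIntegrable (by fun_prop) _ _)
        have := (((hasDerivAt_id y).const_mul (2 * M)).exp).const_mul (D / 2)
        refine this.congr_deriv ?_
        simp only [id]
        ring
      refine (intervalIntegral.norm_integral_le_of_norm_le hx
        (g := fun y => M * D * Real.exp (2 * M * y)) ?_
        (Continuous.intervalIntegrable (by fun_prop) _ _)).trans ?_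
      · refine ae_of_all _ fun y hy => ?_
        have h1 := hYZ y
        simp only [κ, max_eq_left hy.1.le] at h1
        have h2 : ‖F Y y - F Z y‖ ≤ M * ‖Y y - Z y‖ := by
          simp only [F, Prod.mk_sub_mk, ← mul_sub]
          refine max_le ?_ ?_
          · exact (norm_snd_le (Y y - Z y)).trans
              (le_mul_of_one_le_left (norm_nonneg _) (le_max_right _ _))
          · exact (norm_mul_le _ _).trans (mul_le_mul (hHM y) (norm_fst_le (Y y - Z y))
              (norm_nonneg _) hM.le)
        calc _ ≤ M * ‖Y y - Z y‖ := h2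
          _ ≤ M * (D * Real.exp (2 * M * y)) := by gcongr
          _ = _ := by ring
      · rw [hint]
        have : 0 ≤ D / 2 * Real.exp (2 * M * 0) := by positivity
        linarith)
  have hYd : ∀ x, 0 ≤ x → HasDerivWithinAt Y (F Y x) (Ici 0) x := fun x hx => by
    refine (((hd Y hYc x).const_add (a, b)).hasDerivWithinAt).congr (fun z hz => ?_) ?_
    · conv_lhs => rw [← hY]
      simp only [T, max_eq_left (mem_Ici.1 hz)]
    · conv_lhs => rw [← hY]
      simp only [T, max_eq_left hx]
  have hY0 : Y 0 = (a, b) := by rw [← hY]; simp [T]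
  refine ⟨fun x => (Y x).1, fun x => (Y x).2, by simp [hY0], by simp [hY0], fun x hx => ?_,
    fun x hx => ?_⟩
  · exact (ContinuousLinearMap.fst ℝ E E).hasFDerivAt.comp_hasDerivWithinAt x (hYd x hx)
  · have h := (ContinuousLinearMap.snd ℝ E E).hasFDerivAt.comp_hasDerivWithinAt x (hYd x hx)
    simp only [F, H, max_eq_left hx] at h
    exact h

/-- A differential equation on `(0, ∞)` with right side continuous up to `0` holds at `0`
as well. -/
theorem hasDerivWithinAt_of_hasDerivAt_Ioi {F : Type*} [NormedAddCommGroup F] [NormedSpace ℝ F]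
    {χ g : ℝ → F} (hχ : ContinuousOn χ (Ici 0))
    (hd : ∀ x, 0 < x → HasDerivAt χ (g x) x) (hg : ContinuousOn g (Ici 0)) {x : ℝ} (hx : 0 ≤ x) :
    HasDerivWithinAt χ (g x) (Ici 0) x := by
  rcases hx.eq_or_lt with rfl | hx
  · refine hasDerivWithinAt_Ici_of_tendsto_deriv (s := Ioi 0)
      (fun y hy => (hd y hy).differentiableAt.differentiableWithinAt)
      ((hχ 0 self_mem_Ici).mono Ioi_subset_Ici_self) self_mem_nhdsWithin ?_
    exact ((hg 0 self_mem_Ici).mono Ioi_subset_Ici_self).tendsto.congr'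
      (eventually_mem_nhdsWithin.mono fun y hy => (hd y hy).deriv.symm)
  · exact (hd x hx).hasDerivWithinAt

/-- Solutions of `ψ'' = G ψ` on `[0, ∞)` are determined by their initial data. -/
theorem eqOn_of_linear_second_order {G : ℝ → E} {K : ℝ} (hK : ∀ x, 0 ≤ x → ‖G x‖ ≤ K)
    {ψ₁ χ₁ ψ₂ χ₂ : ℝ → E}
    (h₁ : ∀ x, 0 ≤ x → HasDerivWithinAt ψ₁ (χ₁ x) (Ici 0) x)
    (h₁' : ∀ x, 0 ≤ x → HasDerivWithinAt χ₁ (G x * ψ₁ x) (Ici 0) x)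
    (h₂ : ∀ x, 0 ≤ x → HasDerivWithinAt ψ₂ (χ₂ x) (Ici 0) x)
    (h₂' : ∀ x, 0 ≤ x → HasDerivWithinAt χ₂ (G x * ψ₂ x) (Ici 0) x)
    (h0 : ψ₁ 0 = ψ₂ 0) (h0' : χ₁ 0 = χ₂ 0) : EqOn ψ₁ ψ₂ (Ici 0) := by
  intro b hb
  let v : ℝ → E × E → E × E := fun t Y => (Y.2, G t * Y.1)
  have hv : ∀ t ∈ Ico 0 b, LipschitzOnWith (max K 1).toNNReal (v t) univ := fun t ht => by
    refine (LipschitzWith.of_dist_le_mul fun Y Z => ?_).lipschitzOnWith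
    rw [Real.coe_toNNReal _ (by positivity), dist_eq_norm, dist_eq_norm]
    simp only [v, Prod.mk_sub_mk, ← mul_sub]
    refine max_le ?_ ?_
    · exact (norm_snd_le (Y - Z)).trans
        (le_mul_of_one_le_left (norm_nonneg _) (le_max_right _ _))
    · exact (norm_mul_le _ _).trans (mul_le_mul ((hK t ht.1).trans (le_max_left _ _))
        (norm_fst_le (Y - Z)) (norm_nonneg _) (by positivity))
  have hd : ∀ {ψ χ : ℝ → E}, (∀ x, 0 ≤ x → HasDerivWithinAt ψ (χ x) (Ici 0) x) →
      (∀ x, 0 ≤ x → HasDerivWithinAt χ (G x * ψ x) (Ici 0) x) → ∀ t, 0 ≤ t →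
      HasDerivWithinAt (fun x => (ψ x, χ x)) (v t (ψ t, χ t)) (Ici 0) t :=
    fun hψ hχ t ht => (hψ t ht).prodMk (hχ t ht)
  have h := ODE_solution_unique_of_mem_Icc_right (s := fun _ => univ) hv
    (fun t ht => ((hd h₁ h₁' t ht.1).continuousWithinAt).mono Icc_subset_Ici_self)
    (fun t ht => (hd h₁ h₁' t ht.1).mono (Ici_subset_Ici.2 ht.1)) (fun _ _ => mem_univ _)
    (fun t ht => ((hd h₂ h₂' t ht.1).continuousWithinAt).mono Icc_subset_Ici_self)
    (fun t ht => (hd h₂ h₂' t ht.1).mono (Ici_subset_Ici.2 ht.1)) (fun _ _ => mem_univ _)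
    (by rw [h0, h0'])
  exact congrArg Prod.fst (h (right_mem_Icc.2 hb))

end LinearSystem

/-! ### The Jost solution -/

section ExpTail

variable {E : Type*} [NormedAddCommGroup E] [NormedSpace ℂ E]

/-- The function `x ↦ ∫_x^∞ e^{z(y-x)} h(y) dy`, which for `Re z ≤ 0` solves `q' = -z q - h` and
vanishes at infinity. -/
noncomputable def expTail (z : ℂ) (h : ℝ → E) (x : ℝ) : E :=
  Complex.exp (-(z * x)) • ∫ y in Ioi x, Complex.exp (z * y) • h y

variable {z : ℂ} {h : ℝ → E}

theorem norm_exp_mul_ofReal (z : ℂ) (y : ℝ) : ‖Complex.exp (z * y)‖ = Real.exp (z.re * y) := by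
  rw [Complex.norm_exp]
  simp

theorem integrableOn_exp_smul (hz : z.re ≤ 0) (hi : IntegrableOn h (Ioi 0)) :
    IntegrableOn (fun y : ℝ => Complex.exp (z * y) • h y) (Ioi 0) := by
  refine hi.norm.mono'
    ((Continuous.aestronglyMeasurable (by fun_prop)).smul hi.aestronglyMeasurable) ?_
  refine (ae_restrict_mem measurableSet_Ioi).mono fun y hy => ?_
  rw [norm_smul, norm_exp_mul_ofReal]
  refine mul_le_of_le_one_left (norm_nonneg _) (Real.exp_le_one_iff.2 ?_)
  exact mul_nonpos_of_nonpos_of_nonneg hz (le_of_lt hy)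

theorem norm_expTail_le (hz : z.re ≤ 0) (hi : IntegrableOn h (Ioi 0)) {x : ℝ} (hx : 0 ≤ x) :
    ‖expTail z h x‖ ≤ ∫ y in Ioi x, ‖h y‖ := by
  have hi' : IntegrableOn h (Ioi x) := hi.mono_set (Ioi_subset_Ioi hx)
  have h1 : ‖∫ y in Ioi x, Complex.exp (z * y) • h y‖
      ≤ ∫ y in Ioi x, Real.exp (z.re * x) * ‖h y‖ := by
    refine norm_integral_le_of_norm_le (hi'.norm.const_mul _) ?_
    refine (ae_restrict_mem measurableSet_Ioi).mono fun y hy => ?_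
    rw [norm_smul, norm_exp_mul_ofReal]
    exact mul_le_mul_of_nonneg_right
      (Real.exp_le_exp.2 (mul_le_mul_of_nonpos_left (le_of_lt hy) hz)) (norm_nonneg _)
  rw [integral_const_mul] at h1
  rw [expTail, norm_smul, ← neg_mul, norm_exp_mul_ofReal]
  calc _ ≤ Real.exp ((-z).re * x) * (Real.exp (z.re * x) * ∫ y in Ioi x, ‖h y‖) := by gcongr
    _ = _ := by
      rw [← mul_assoc, ← Real.exp_add]
      simp

theorem tendsto_expTail (hz : z.re ≤ 0) (hi : IntegrableOn h (Ioi 0)) :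
    Tendsto (expTail z h) atTop (𝓝 0) :=
  squeeze_zero_norm' ((eventually_ge_atTop 0).mono fun _ hx => norm_expTail_le hz hi hx)
    (tendsto_tail hi.norm)

theorem hasDerivAt_cexp_mul_ofReal (z : ℂ) (x : ℝ) :
    HasDerivAt (fun y : ℝ => Complex.exp (z * y)) (z * Complex.exp (z * x)) x := by
  have h1 : HasDerivAt (fun y : ℝ => z * (y : ℂ)) z x := by
    simpa using (Complex.ofRealCLM.hasDerivAt (x := x)).const_mul z
  rw [mul_comm z (Complex.exp _)]
  exact h1.cexp

theorem hasDerivAt_expTail [CompleteSpace E] (hz : z.re ≤ 0) (hc : Continuous h)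
    (hi : IntegrableOn h (Ioi 0)) (x : ℝ) :
    HasDerivAt (expTail z h) (-(z • expTail z h x) - h x) x := by
  have h1 := hasDerivAt_tail (h := fun y : ℝ => Complex.exp (z * y) • h y) (by fun_prop)
    (integrableOn_exp_smul hz hi) x
  have h2 := (hasDerivAt_cexp_mul_ofReal (-z) x).smul h1
  simp only [neg_mul] at h2
  refine h2.congr_deriv ?_
  rw [smul_neg, smul_smul, ← Complex.exp_add, neg_add_cancel, Complex.exp_zero, one_smul,
    neg_smul, mul_smul, expTail]
  abel

theorem expTail_sub {g : ℝ → E} (hz : z.re ≤ 0) (hg : IntegrableOn g (Ioi 0))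
    (hi : IntegrableOn h (Ioi 0)) {x : ℝ} (hx : 0 ≤ x) :
    expTail z (fun y => g y - h y) x = expTail z g x - expTail z h x := by
  simp only [expTail, smul_sub]
  rw [integral_sub ((integrableOn_exp_smul hz hg).mono_set (Ioi_subset_Ioi hx))
    ((integrableOn_exp_smul hz hi).mono_set (Ioi_subset_Ioi hx)), smul_sub]

/-- A solution of `u'' = h - z u'` with `u → c` and `u' → 0` at infinity is given by the integrals
of `h` from infinity. -/
theorem eq_expTail_of_hasDerivAt [CompleteSpace E] (hz : z.re ≤ 0) (hz0 : z ≠ 0) {u p : ℝ → E}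
    {c : E} (hi : IntegrableOn h (Ioi 0))
    (hu : ∀ x, 0 ≤ x → HasDerivWithinAt u (p x) (Ici 0) x)
    (hp : ∀ x, 0 ≤ x → HasDerivWithinAt p (h x - z • p x) (Ici 0) x)
    (hul : Tendsto u atTop (𝓝 c)) (hpl : Tendsto p atTop (𝓝 0)) {x : ℝ} (hx : 0 ≤ x) :
    p x = -expTail z h x ∧ u x = c + z⁻¹ • (expTail z h x - ∫ y in Ioi x, h y) := by
  have hpos : ∀ y ∈ Ioi x, 0 < y := fun y hy => hx.trans_lt hy
  have hu' : ∀ y ∈ Ioi x, HasDerivAt u (p y) y := fun y hy =>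
    (hu y (hpos y hy).le).hasDerivAt (Ici_mem_nhds (hpos y hy))
  have hp' : ∀ y ∈ Ioi x, HasDerivAt p (h y - z • p y) y := fun y hy =>
    (hp y (hpos y hy).le).hasDerivAt (Ici_mem_nhds (hpos y hy))
  have hsub : Ici x ⊆ Ici 0 := Ici_subset_Ici.2 hx
  have hpc : ContinuousWithinAt p (Ici x) x := (hp x hx).continuousWithinAt.mono hsub
  have huc : ContinuousWithinAt u (Ici x) x := (hu x hx).continuousWithinAt.mono hsub
  have h1 := integral_Ioi_of_hasDerivAt_of_tendsto (a := x) (m := 0)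
    (f := fun y : ℝ => Complex.exp (z * y) • p y) (f' := fun y : ℝ => Complex.exp (z * y) • h y)
    ((Continuous.continuousWithinAt (by fun_prop)).smul hpc)
    (fun y hy => by
      refine ((hasDerivAt_cexp_mul_ofReal z y).smul (hp' y hy)).congr_deriv ?_
      rw [smul_sub, smul_smul, mul_comm (Complex.exp _) z, sub_add_cancel])
    ((integrableOn_exp_smul hz hi).mono_set (Ioi_subset_Ioi hx))
    (squeeze_zero_norm' (a := fun y => ‖p y‖) ((eventually_ge_atTop 0).mono fun y hy => by
      rw [norm_smul, norm_exp_mul_ofReal]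
      exact mul_le_of_le_one_left (norm_nonneg _)
        (Real.exp_le_one_iff.2 (mul_nonpos_of_nonpos_of_nonneg hz hy))) (by simpa using hpl.norm))
  have h2 := integral_Ioi_of_hasDerivAt_of_tendsto (a := x) (m := c)
    (f := fun y : ℝ => u y + z⁻¹ • p y) (f' := fun y : ℝ => z⁻¹ • h y)
    (huc.add (hpc.const_smul z⁻¹))
    (fun y hy => by
      refine ((hu' y hy).add ((hp' y hy).const_smul z⁻¹)).congr_deriv ?_
      rw [smul_sub, inv_smul_smul₀ hz0, add_sub_cancel])
    ((hi.mono_set (Ioi_subset_Ioi hx)).smul _)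
    (by simpa using hul.add (hpl.const_smul z⁻¹))
  have hpx : p x = -expTail z h x := by
    rw [expTail, h1, zero_sub, smul_neg, neg_neg, smul_smul, ← Complex.exp_add, neg_add_cancel,
      Complex.exp_zero, one_smul]
  refine ⟨hpx, ?_⟩
  rw [integral_smul, hpx] at h2
  rw [smul_sub, h2, smul_neg]
  abel

theorem exists_bound_of_tendsto {E : Type*} [NormedAddCommGroup E] {u : ℝ → E} {c : E}
    (hu : ContinuousOn u (Ici 0)) (hl : Tendsto u atTop (𝓝 c)) : ∃ C, 0 ≤ C ∧ ∀ x, 0 ≤ x → ‖u x‖ ≤ C := by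
  obtain ⟨b, hb⟩ := eventually_atTop.1 (hl.norm.eventually (eventually_lt_nhds (lt_add_one ‖c‖)))
  obtain ⟨C, hC⟩ := (isCompact_Icc (a := (0 : ℝ)) (b := b)).exists_bound_of_continuousOn
    (hu.mono Icc_subset_Ici_self)
  refine ⟨max (max C (‖c‖ + 1)) 0, le_max_right _ _, fun x hx => le_max_of_le_left ?_⟩
  rcases le_total x b with h | h
  · exact (hC x ⟨hx, h⟩).trans (le_max_left _ _)
  · exact (hb x h).le.trans (le_max_right _ _)

end ExpTail

section Jost

variable {E : Type*} [NormedRing E] [NormedAlgebra ℂ E]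

/-- `u` is the normalized Jost solution `e^{-ikx} f(k, x)` and `p` its derivative, where `z = 2ik`:
the equation `-f'' + W f = k² f` becomes `u'' + z u' = W u`, and `u → 1`, `u' → 0` at infinity. -/
structure IsNormalizedJost (W : ℝ → E) (z : ℂ) (u p : ℝ → E) : Prop where
  hasDeriv_fst : ∀ x, 0 ≤ x → HasDerivWithinAt u (p x) (Ici 0) x
  hasDeriv_snd : ∀ x, 0 ≤ x → HasDerivWithinAt p (W x * u x - z • p x) (Ici 0) x
  tendsto_fst : Tendsto u atTop (𝓝 1)
  tendsto_snd : Tendsto p atTop (𝓝 0)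

/-- `C / (r - 1) (1 + x)^(1 - r)` is the tail integral of `C (1 + x)^(-r)`. -/
theorem hasDerivAt_decay_primitive {C r x : ℝ} (hr : 1 < r) (hx : 0 ≤ x) :
    HasDerivAt (fun x : ℝ => C / (r - 1) * (1 + x) ^ (1 - r)) (-(C * (1 + x) ^ (-r))) x := by
  have h := ((((hasDerivAt_id x).const_add 1).rpow_const (p := 1 - r)
    (Or.inl (by simp only [id]; linarith))).const_mul (C / (r - 1)))
  refine h.congr_deriv ?_
  have : r - 1 ≠ 0 := by linarith
  rw [show 1 - r - 1 = -r by ring]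
  simp only [id]
  field_simp
  ring

theorem integral_decay_mul_exp {C r l X : ℝ} (hC : 0 ≤ C) (hr : 1 < r) (hl : 0 < l) (hX : 0 ≤ X) :
    IntegrableOn
      (fun y : ℝ => C * (1 + y) ^ (-r) * Real.exp (l * (C / (r - 1) * (1 + y) ^ (1 - r))))
      (Ioi X) ∧
    ∫ y in Ioi X, C * (1 + y) ^ (-r) * Real.exp (l * (C / (r - 1) * (1 + y) ^ (1 - r)))
      ≤ Real.exp (l * (C / (r - 1) * (1 + X) ^ (1 - r))) / l := by
  have hd : ∀ y ∈ Ici X, HasDerivAt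
      (fun y => -(Real.exp (l * (C / (r - 1) * (1 + y) ^ (1 - r))) / l))
      (C * (1 + y) ^ (-r) * Real.exp (l * (C / (r - 1) * (1 + y) ^ (1 - r)))) y := fun y hy => by
    have h := (((hasDerivAt_decay_primitive (C := C) hr (hX.trans hy)).const_mul l).exp.div_const
      l).neg
    refine h.congr_deriv ?_
    field_simp
  have hlim : Tendsto (fun y => -(Real.exp (l * (C / (r - 1) * (1 + y) ^ (1 - r))) / l)) atTop
      (𝓝 (-(Real.exp (l * (C / (r - 1) * 0)) / l))) := by
    refine (((Real.continuous_exp.tendsto _).comp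
      (((?_ : Tendsto _ _ _).const_mul _).const_mul l)).div_const l).neg
    have := (tendsto_rpow_neg_atTop (show 0 < r - 1 by linarith)).comp
      (tendsto_atTop_add_const_left atTop (1 : ℝ) tendsto_id)
    simpa [Function.comp_def] using this
  have hnn : ∀ y ∈ Ioi X, 0 ≤ C * (1 + y) ^ (-r) *
      Real.exp (l * (C / (r - 1) * (1 + y) ^ (1 - r))) := fun y hy => by
    have : 0 ≤ y := hX.trans (le_of_lt hy)
    positivity
  have hi := integrableOn_Ioi_deriv_of_nonneg' hd hnn hlim
  refine ⟨hi, ?_⟩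
  rw [integral_Ioi_of_hasDerivAt_of_tendsto' hd hi hlim]
  have : 0 ≤ Real.exp (l * (C / (r - 1) * 0)) / l := by positivity
  linarith

variable [CompleteSpace E] {W : ℝ → E} {z : ℂ} {C r : ℝ}

/-- Existence and uniqueness of the Jost solution. With `Q(x) = ∫_x^∞ C (1 + y)^(-r) dy`, the
Volterra equation `u(x) = 1 + z⁻¹ ∫_x^∞ (e^{z(y-x)} - 1) W(y) u(y) dy` is a contraction for the
weight `e^{λQ}` as soon as `λ ≥ 4 / ‖z‖`. -/
theorem exists_isNormalizedJost (hr : 1 < r) (hW : ContinuousOn W (Ici 0))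
    (hWC : ∀ x, 0 ≤ x → ‖W x‖ ≤ C * (1 + x) ^ (-r)) (hz : z.re ≤ 0) (hz0 : z ≠ 0) :
    (∃ u p, IsNormalizedJost W z u p) ∧ ∀ u₁ p₁ u₂ p₂, IsNormalizedJost W z u₁ p₁ →
      IsNormalizedJost W z u₂ p₂ → EqOn u₁ u₂ (Ici 0) := by
  have hC : 0 ≤ C := by
    have := (norm_nonneg _).trans (hWC 0 le_rfl)
    simpa using this
  -- extended by a constant to `(-∞, 0]`, the coefficient is continuous on the whole line
  let H : ℝ → E := fun x => W (max x 0)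
  have hH : Continuous H := continuous_comp_max hW
  have hHW : ∀ x, 0 ≤ x → H x = W x := fun x hx => by simp only [H, max_eq_left hx]
  have hmeas : ∀ u : ℝ → E, Continuous u → (∃ B, ∀ x, ‖u x‖ ≤ B) →
      IntegrableOn (fun y => H y * u y) (Ioi 0) := by
    rintro u hu ⟨B, hB⟩
    have h := (integrableOn_add_rpow_Ioi_of_lt (a := -r) (c := 0) (m := 1) (by linarith)
      (by norm_num)).const_mul (C * B)
    refine h.mono' (hH.mul hu).aestronglyMeasurable ?_
    refine (ae_restrict_mem measurableSet_Ioi).mono fun y hy => ?_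
    have hy' : (0:ℝ) ≤ y := le_of_lt hy
    rw [add_comm y 1]
    calc _ ≤ ‖H y‖ * ‖u y‖ := norm_mul_le _ _
      _ ≤ (C * (1 + y) ^ (-r)) * B := by
        rw [hHW y hy']
        exact mul_le_mul (hWC y hy') (hB y) (norm_nonneg _) (by positivity)
      _ = _ := by ring
  let S : (ℝ → E) → ℝ → E := fun u x =>
    1 + z⁻¹ • (expTail z (fun y => H y * u y) x - ∫ y in Ioi x, H y * u y)
  have hSd : ∀ u : ℝ → E, Continuous u → (∃ B, ∀ x, ‖u x‖ ≤ B) → ∀ x,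
      HasDerivAt (S u) (-expTail z (fun y => H y * u y) x) x := fun u hu hB x => by
    have h1 := hasDerivAt_expTail (h := fun y => H y * u y) hz (hH.mul hu) (hmeas u hu hB) x
    have h2 := hasDerivAt_tail (h := fun y => H y * u y) (hH.mul hu) (hmeas u hu hB) x
    refine (((h1.sub h2).const_smul z⁻¹).const_add 1).congr_deriv ?_
    rw [sub_neg_eq_add, sub_add_cancel, smul_neg, inv_smul_smul₀ hz0]
  let l : ℝ := 4 / ‖z‖
  have hzn : 0 < ‖z‖ := norm_pos_iff.2 hz0
  have hl : 0 < l := by positivity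
  let Q : ℝ → ℝ := fun x => C / (r - 1) * (1 + x) ^ (1 - r)
  have hr1 : 0 < r - 1 := by linarith
  let κ : ℝ → ℝ := fun x => Real.exp (l * Q (max x 0))
  have hκc : Continuous κ := by
    refine Real.continuous_exp.comp (continuous_const.mul (continuous_const.mul ?_))
    exact Continuous.rpow_const (by fun_prop) fun x => Or.inl (by positivity)
  have hκ1 : ∀ x, 1 ≤ κ x := fun x => Real.one_le_exp (by positivity)
  have hκB : ∃ B, ∀ x, κ x ≤ B := by
    refine ⟨Real.exp (l * (C / (r - 1) * 1)), fun x => ?_⟩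
    have : (1 + max x 0) ^ (1 - r) ≤ 1 :=
      Real.rpow_le_one_of_one_le_of_nonpos (by simp) (by linarith)
    simp only [κ, Q]
    gcongr
  obtain ⟨B, hB⟩ := hκB
  have hbdd : ∀ u : ℝ → E, (∃ D, ∀ x, ‖u x‖ ≤ D * κ x) → ∃ D, ∀ x, ‖u x‖ ≤ D := by
    rintro u ⟨D, hD⟩
    refine ⟨max D 0 * B, fun x => (hD x).trans ?_⟩
    have := (zero_le_one.trans (hκ1 x))
    calc D * κ x ≤ max D 0 * κ x := by gcongr; exact le_max_left _ _
      _ ≤ _ := by gcongr; exact hB x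
  have hfix := existsUnique_fixedPoint_of_weight (E := E) (κ := κ)
    (T := fun u x => S u (max x 0)) hκc (fun x => zero_lt_one.trans_le (hκ1 x))
    (fun u hu hb => (continuous_iff_continuousAt.2 fun x =>
      (hSd u hu (hbdd u hb) x).continuousAt).comp (by fun_prop))
    ⟨‖(1 : E)‖, fun x => by
      have : S 0 (max x 0) = 1 := by simp [S, expTail]
      rw [this]
      exact le_mul_of_one_le_right (norm_nonneg _) (hκ1 x)⟩
    (fun u v hu hv hub hvb D hD huv x => by
      have hx : 0 ≤ max x 0 := le_max_right _ _
      change ‖S u (max x 0) - S v (max x 0)‖ ≤ D / 2 * Real.exp (l * Q (max x 0))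
      generalize max x 0 = X at hx
      have hiu := hmeas u hu (hbdd u hub)
      have hiv := hmeas v hv (hbdd v hvb)
      have hi : IntegrableOn (fun y => H y * u y - H y * v y) (Ioi 0) := hiu.sub hiv
      have hSS : S u X - S v X = z⁻¹ • (expTail z (fun y => H y * u y - H y * v y) X
          - ∫ y in Ioi X, (H y * u y - H y * v y)) := by
        rw [expTail_sub hz hiu hiv hx, integral_sub (hiu.mono_set (Ioi_subset_Ioi hx))
          (hiv.mono_set (Ioi_subset_Ioi hx))]
        simp only [S, smul_sub]
        abel
      obtain ⟨hQi, hQ⟩ := integral_decay_mul_exp hC hr hl hx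
      have hbound : ∫ y in Ioi X, ‖H y * u y - H y * v y‖ ≤ D * (Real.exp (l * Q X) / l) := by
        refine le_trans ?_ (mul_le_mul_of_nonneg_left hQ hD)
        rw [← integral_const_mul]
        refine setIntegral_mono_on (hi.mono_set (Ioi_subset_Ioi hx)).norm (hQi.const_mul D)
          measurableSet_Ioi fun y hy => ?_
        have hy0 : 0 ≤ y := hx.trans (le_of_lt hy)
        have h1 := huv y
        simp only [κ, max_eq_left hy0] at h1
        rw [← mul_sub, hHW y hy0]
        calc _ ≤ ‖W y‖ * ‖u y - v y‖ := norm_mul_le _ _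
          _ ≤ (C * (1 + y) ^ (-r)) * (D * Real.exp (l * Q y)) :=
            mul_le_mul (hWC y hy0) h1 (norm_nonneg _) (by positivity)
          _ = _ := by simp only [Q]; ring
      have h2 := norm_expTail_le hz hi hx
      have h3 := norm_integral_le_integral_norm (μ := volume.restrict (Ioi X))
        (fun y => H y * u y - H y * v y)
      rw [hSS, norm_smul, norm_inv]
      calc _ ≤ ‖z‖⁻¹ * (D * (Real.exp (l * Q X) / l) + D * (Real.exp (l * Q X) / l)) := by
            refine mul_le_mul_of_nonneg_left ((norm_sub_le _ _).trans ?_) (by positivity)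
            exact add_le_add (h2.trans hbound) (h3.trans hbound)
        _ = _ := by
            simp only [l]
            field_simp
            ring)
  constructor
  · obtain ⟨u, ⟨⟨huc, hub⟩, hu⟩, -⟩ := hfix
    have hub' := hbdd u hub
    have hi := hmeas u huc hub'
    have huS : ∀ x, 0 ≤ x → u x = S u x := fun x hx => by
      have := congrFun hu x
      simp only [max_eq_left hx] at this
      exact this.symm
    refine ⟨S u, fun x => -expTail z (fun y => H y * u y) x,
      fun x _ => (hSd u huc hub' x).hasDerivWithinAt, fun x hx => ?_, ?_, ?_⟩
    · refine ((hasDerivAt_expTail (h := fun y => H y * u y) hz (hH.mul huc) hi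
        x).neg.congr_deriv ?_).hasDerivWithinAt
      rw [hHW x hx, huS x hx, smul_neg]
      abel
    · have := (((tendsto_expTail hz hi).sub (tendsto_tail hi)).const_smul z⁻¹).const_add (1 : E)
      simpa using this
    · simpa using (tendsto_expTail hz hi).neg
  · have key : ∀ u p, IsNormalizedJost W z u p → (Continuous (fun x => u (max x 0)) ∧
        ∃ D, ∀ x, ‖u (max x 0)‖ ≤ D * κ x) ∧
        (fun x => S (fun x => u (max x 0)) (max x 0)) = fun x => u (max x 0) := by
      intro u p h
      have hc : ContinuousOn u (Ici 0) := fun x hx => (h.hasDeriv_fst x hx).continuousWithinAt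
      obtain ⟨D, hD0, hD⟩ := exists_bound_of_tendsto hc h.tendsto_fst
      have hc' := continuous_comp_max hc
      refine ⟨⟨hc', D, fun x => (hD _ (le_max_right _ _)).trans
        (le_mul_of_one_le_right hD0 (hκ1 x))⟩, ?_⟩
      have hi := hmeas _ hc' ⟨D, fun x => hD _ (le_max_right _ _)⟩
      funext x
      exact (eq_expTail_of_hasDerivAt hz hz0 hi h.hasDeriv_fst (fun y hy => by
        simp only [hHW y hy, max_eq_left hy]
        exact h.hasDeriv_snd y hy) h.tendsto_fst h.tendsto_snd (le_max_right x 0)).2.symm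
    intro u₁ p₁ u₂ p₂ h₁ h₂ x hx
    have := congrFun (hfix.unique (key u₁ p₁ h₁) (key u₂ p₂ h₂)) x
    simpa only [max_eq_left (mem_Ici.1 hx)] using this

/-- A priori bound for the inhomogeneous equation `R'' + z R' = W R + g` with zero data at
infinity: for large `z` the potential term is absorbed in the left side. -/
theorem norm_le_of_inhomogeneous (hz : z.re ≤ 0) (hz0 : z ≠ 0)
    (hW : ContinuousOn W (Ici 0)) (hWi : IntegrableOn W (Ioi 0))
    (hzW : 4 * ∫ y in Ioi 0, ‖W y‖ ≤ ‖z‖) {g R P : ℝ → E}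
    (hg : IntegrableOn g (Ioi 0))
    (hR : ∀ x, 0 ≤ x → HasDerivWithinAt R (P x) (Ici 0) x)
    (hP : ∀ x, 0 ≤ x → HasDerivWithinAt P (W x * R x + g x - z • P x) (Ici 0) x)
    (hRl : Tendsto R atTop (𝓝 0)) (hPl : Tendsto P atTop (𝓝 0)) :
    ‖R 0‖ ≤ 4 * (∫ y in Ioi 0, ‖g y‖) / ‖z‖ ∧ ‖P 0‖ ≤ 2 * ∫ y in Ioi 0, ‖g y‖ := by
  have hzn : 0 < ‖z‖ := norm_pos_iff.2 hz0
  have hRc : ContinuousOn R (Ici 0) := fun x hx => (hR x hx).continuousWithinAt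
  obtain ⟨D₀, hD₀, hRD₀⟩ := exists_bound_of_tendsto hRc hRl
  -- the least bound of `R` on the half line
  let D : ℝ := ⨆ x : Ici (0 : ℝ), ‖R x‖
  have hbdd : BddAbove (range fun x : Ici (0 : ℝ) => ‖R x‖) :=
    ⟨D₀, by rintro _ ⟨x, rfl⟩; exact hRD₀ x x.2⟩
  have hRD : ∀ x, 0 ≤ x → ‖R x‖ ≤ D := fun x hx => le_ciSup hbdd ⟨x, hx⟩
  have hD : 0 ≤ D := (norm_nonneg _).trans (hRD 0 le_rfl)
  set K := ∫ y in Ioi 0, ‖W y‖ with hK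
  set G := ∫ y in Ioi 0, ‖g y‖ with hG
  have hK0 : 0 ≤ K := integral_nonneg fun _ => norm_nonneg _
  have hWR : IntegrableOn (fun y => W y * R y) (Ioi 0) := by
    refine (hWi.norm.mul_const D).mono' (((hW.mul hRc).mono
      Ioi_subset_Ici_self).aestronglyMeasurable measurableSet_Ioi) ?_
    refine (ae_restrict_mem measurableSet_Ioi).mono fun y hy => (norm_mul_le _ _).trans ?_
    exact mul_le_mul_of_nonneg_left (hRD y (le_of_lt hy)) (norm_nonneg _)
  have hi : IntegrableOn (fun y => W y * R y + g y) (Ioi 0) := hWR.add hg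
  have hI : ∀ x, 0 ≤ x → ∫ y in Ioi x, ‖W y * R y + g y‖ ≤ K * D + G := fun x hx => by
    calc _ ≤ ∫ y in Ioi 0, ‖W y * R y + g y‖ := setIntegral_mono_set hi.norm
          (ae_of_all _ fun _ => norm_nonneg _) (Ioi_subset_Ioi hx).eventuallyLE
      _ ≤ ∫ y in Ioi 0, (‖W y‖ * D + ‖g y‖) := by
          refine setIntegral_mono_on hi.norm ((hWi.norm.mul_const D).add hg.norm)
            measurableSet_Ioi fun y hy => (norm_add_le _ _).trans ?_
          refine add_le_add_left ((norm_mul_le _ _).trans ?_) _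
          exact mul_le_mul_of_nonneg_left (hRD y (le_of_lt hy)) (norm_nonneg _)
      _ = K * D + G := by
          rw [integral_add (hWi.norm.mul_const D) hg.norm, integral_mul_const]
  have hrep := fun x (hx : 0 ≤ x) => eq_expTail_of_hasDerivAt hz hz0 hi hR hP hRl hPl hx
  have hDle : D ≤ ‖z‖⁻¹ * (2 * (K * D + G)) := by
    have : Nonempty (Ici (0 : ℝ)) := ⟨⟨0, self_mem_Ici⟩⟩
    refine ciSup_le fun x => ?_
    rw [(hrep x x.2).2, zero_add, norm_smul, norm_inv]
    refine mul_le_mul_of_nonneg_left ((norm_sub_le _ _).trans ?_) (by positivity)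
    rw [two_mul]
    exact add_le_add ((norm_expTail_le hz hi x.2).trans (hI x x.2))
      ((norm_integral_le_integral_norm _).trans (hI x x.2))
  have hDle' : ‖z‖ * D ≤ 2 * (K * D + G) := by
    rwa [← le_inv_mul_iff₀ hzn]
  have hKD : 4 * K * D ≤ ‖z‖ * D := mul_le_mul_of_nonneg_right hzW hD
  have hzD : ‖z‖ * D ≤ 4 * G := by linarith
  constructor
  · rw [le_div_iff₀ hzn, mul_comm]
    exact (mul_le_mul_of_nonneg_left (hRD 0 le_rfl) hzn.le).trans hzD
  · rw [(hrep 0 le_rfl).1, norm_neg]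
    refine (norm_expTail_le hz hi le_rfl).trans ((hI 0 le_rfl).trans ?_)
    linarith

end Jost

/-! ### Large energy expansion of the Jost solution -/

section Expansion

theorem SmoothDecay.tendsto_zero {E : Type*} [NormedAddCommGroup E] [NormedSpace ℝ E] {r : ℝ}
    {G : ℝ → E} (hr : 0 < r) (hG : SmoothDecay r G) : Tendsto G atTop (𝓝 0) := by
  obtain ⟨C, -, hC⟩ := hG.exists_norm_le
  refine squeeze_zero_norm' ((eventually_ge_atTop 0).mono hC) ?_
  have := ((tendsto_rpow_neg_atTop hr).comp
    (tendsto_atTop_add_const_left atTop (1 : ℝ) tendsto_id)).const_mul C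
  simpa [Function.comp_def] using this

variable {E : Type*} [NormedRing E] [NormedAlgebra ℂ E] {W : ℝ → E} {b : ℕ → ℝ → E} {r : ℝ}

/-- The recursion `b₀ = 1`, `b_{l+1}(x) = -b_l'(x) - ∫_x^∞ W b_l` on the half line, obtained by
inserting `∑ b_l(x) z⁻ˡ` into `u'' + z u' = W u`. -/
structure IsExpansionCoeff (W : ℝ → E) (b : ℕ → ℝ → E) : Prop where
  zero : ∀ x, 0 ≤ x → b 0 x = 1
  succ : ∀ l x, 0 ≤ x → b (l + 1) x = -derivWithin (b l) (Ici 0) x - ∫ y in Ioi x, W y * b l y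

namespace IsExpansionCoeff

theorem derivWithin_zero (hb : IsExpansionCoeff W b) {x : ℝ} (hx : 0 ≤ x) :
    derivWithin (b 0) (Ici 0) x = 0 := by
  rw [derivWithin_congr (s := Ici 0) (fun y hy => hb.zero y hy) (hb.zero x hx)]
  simp

variable [CompleteSpace E]

/-- The induction keeps `b_l` bounded with all derivatives and `b_l'` decaying like `W`: both
properties pass through `b ↦ -b' - ∫_x^∞ W b`. -/
theorem smoothDecay (hb : IsExpansionCoeff W b) (hr : 1 < r) (hW : SmoothDecay r W) (l : ℕ) :
    SmoothDecay 0 (b l) ∧ SmoothDecay r (derivWithin (b l) (Ici 0)) := by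
  induction l with
  | zero =>
    refine ⟨(SmoothDecay.const (1 : E)).congr hb.zero, ?_⟩
    have h0 : SmoothDecay r (fun _ : ℝ => (0 : E)) :=
      ⟨contDiffOn_const, fun j => ⟨0, fun x _ => by rw [iteratedDerivWithin_const]; simp⟩⟩
    exact h0.congr fun x hx => hb.derivWithin_zero hx
  | succ l ih =>
    have hWb : SmoothDecay r fun y => W y * b l y := by simpa using hW.mul ih.1
    have htail := hWb.tail hr
    have hd : ∀ x, 0 ≤ x → HasDerivWithinAt (b (l + 1))
        (-derivWithin (derivWithin (b l) (Ici 0)) (Ici 0) x + W x * b l x) (Ici 0) x := by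
      intro x hx
      have h1 := (ih.2.hasDerivWithinAt hx).neg
      have h2 := hasDerivWithinAt_tail hWb.continuousOn (hWb.integrableOn hr) hx
      exact ((h1.sub h2).congr (fun y hy => hb.succ l y hy) (hb.succ l x hx)).congr_deriv
        (sub_neg_eq_add _ _)
    constructor
    · refine ((ih.2.mono (by linarith)).neg.add htail.neg).congr fun x hx => ?_
      rw [hb.succ l x hx, sub_eq_add_neg]
    · exact (ih.2.derivWithin.neg.add hWb).congr fun x hx =>
        (hd x hx).derivWithin (uniqueDiffOn_Ici 0 x hx)

theorem derivWithin_derivWithin (hb : IsExpansionCoeff W b) (hr : 1 < r) (hW : SmoothDecay r W)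
    (l : ℕ) {x : ℝ} (hx : 0 ≤ x) : derivWithin (derivWithin (b l) (Ici 0)) (Ici 0) x
      = W x * b l x - derivWithin (b (l + 1)) (Ici 0) x := by
  obtain ⟨h0, h1⟩ := hb.smoothDecay hr hW l
  have hWb : SmoothDecay r fun y => W y * b l y := by simpa using hW.mul h0
  have h2 := hasDerivWithinAt_tail hWb.continuousOn (hWb.integrableOn hr) hx
  have h3 := ((h1.hasDerivWithinAt hx).neg.sub h2).congr (fun y hy => hb.succ l y hy)
    (hb.succ l x hx)
  rw [h3.derivWithin (uniqueDiffOn_Ici 0 x hx)]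
  abel

theorem tendsto (hb : IsExpansionCoeff W b) (hr : 1 < r) (hW : SmoothDecay r W) (l : ℕ) :
    Tendsto (b l) atTop (𝓝 (if l = 0 then 1 else 0)) := by
  cases l with
  | zero =>
    exact tendsto_const_nhds.congr' ((eventually_ge_atTop 0).mono fun x hx => (hb.zero x hx).symm)
  | succ l =>
    obtain ⟨h0, h1⟩ := hb.smoothDecay hr hW l
    have hWb : SmoothDecay r fun y => W y * b l y := by simpa using hW.mul h0
    have h := (h1.tendsto_zero (by linarith)).neg.sub (tendsto_tail (hWb.integrableOn hr))
    simp only [neg_zero, sub_zero] at h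
    rw [if_neg (Nat.succ_ne_zero l)]
    exact h.congr' ((eventually_ge_atTop 0).mono fun x hx => (hb.succ l x hx).symm)

/-- The partial sums of `∑ b_l z⁻ˡ` approximate the normalized Jost solution at `0`: the error
solves the Jost equation with zero data at infinity and inhomogeneity `z⁻ᴸ b_{L+1}'`. -/
theorem norm_jost_sub_le (hb : IsExpansionCoeff W b) (hr : 1 < r) (hW : SmoothDecay r W) {z : ℂ}
    (hz : z.re ≤ 0) (hz0 : z ≠ 0) (hzW : 4 * ∫ y in Ioi 0, ‖W y‖ ≤ ‖z‖) {u p : ℝ → E}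
    (h : IsNormalizedJost W z u p) (L : ℕ) :
    ‖u 0 - ∑ l ∈ Finset.range (L + 1), z⁻¹ ^ l • b l 0‖
        ≤ 4 * (‖z‖⁻¹ ^ L * ∫ y in Ioi 0, ‖derivWithin (b (L + 1)) (Ici 0) y‖) / ‖z‖ ∧
      ‖p 0 - ∑ l ∈ Finset.range (L + 1), z⁻¹ ^ l • derivWithin (b l) (Ici 0) 0‖
        ≤ 2 * (‖z‖⁻¹ ^ L * ∫ y in Ioi 0, ‖derivWithin (b (L + 1)) (Ici 0) y‖) := by
  have hsm := hb.smoothDecay hr hW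
  -- the terms telescope because `b_0' = 0`
  have hsum : ∀ x, 0 ≤ x → ∑ l ∈ Finset.range (L + 1), z⁻¹ ^ l • derivWithin (b (l + 1)) (Ici 0) x
      = z • (∑ l ∈ Finset.range (L + 1), z⁻¹ ^ l • derivWithin (b l) (Ici 0) x)
        + z⁻¹ ^ L • derivWithin (b (L + 1)) (Ici 0) x := by
    intro x hx
    rw [Finset.sum_range_succ, Finset.sum_range_succ', hb.derivWithin_zero hx, smul_zero, add_zero,
      Finset.smul_sum]
    congr 1
    refine Finset.sum_congr rfl fun l _ => ?_
    rw [smul_smul, pow_succ', mul_inv_cancel_left₀ hz0]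
  have key := norm_le_of_inhomogeneous (W := W) hz hz0 hW.continuousOn (hW.integrableOn hr) hzW
    (g := fun x => z⁻¹ ^ L • derivWithin (b (L + 1)) (Ici 0) x)
    (R := fun x => u x - ∑ l ∈ Finset.range (L + 1), z⁻¹ ^ l • b l x)
    (P := fun x => p x - ∑ l ∈ Finset.range (L + 1), z⁻¹ ^ l • derivWithin (b l) (Ici 0) x)
    (((hsm (L + 1)).2.integrableOn hr).smul (z⁻¹ ^ L))
    (fun x hx => (h.hasDeriv_fst x hx).sub (HasDerivWithinAt.fun_sum fun l _ =>
      ((hsm l).1.hasDerivWithinAt hx).fun_const_smul (z⁻¹ ^ l)))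
    (fun x hx => by
      refine ((h.hasDeriv_snd x hx).fun_sub (HasDerivWithinAt.fun_sum fun l _ =>
        ((hsm l).2.hasDerivWithinAt hx).fun_const_smul (z⁻¹ ^ l))).congr_deriv ?_
      simp only [hb.derivWithin_derivWithin hr hW _ hx, smul_sub, Finset.sum_sub_distrib, hsum x hx,
        mul_sub, Finset.mul_sum, mul_smul_comm]
      abel)
    (by
      have h1 := h.tendsto_fst.sub (tendsto_finsetSum (Finset.range (L + 1)) fun l _ =>
        (hb.tendsto hr hW l).const_smul (z⁻¹ ^ l))
      simpa using h1)
    (by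
      have h1 := h.tendsto_snd.sub (tendsto_finsetSum (Finset.range (L + 1)) fun l _ =>
        ((hsm l).2.tendsto_zero (by linarith)).const_smul (z⁻¹ ^ l))
      simpa using h1)
  have hG : ∫ y in Ioi (0 : ℝ), ‖z⁻¹ ^ L • derivWithin (b (L + 1)) (Ici 0) y‖
      = ‖z‖⁻¹ ^ L * ∫ y in Ioi 0, ‖derivWithin (b (L + 1)) (Ici 0) y‖ := by
    simp only [norm_smul, norm_pow, norm_inv]
    rw [integral_const_mul]
  rwa [hG] at key

end IsExpansionCoeff

end Expansion

/-! ### The Jost and regular solutions of the matrix equation -/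

section MatrixSolutions

variable {n : ℕ} {V W : ℝ → Matrix (Fin n) (Fin n) ℂ} {k : ℂ}

theorem halfDeriv_eq_of_hasDerivWithinAt {F : ℝ → Matrix (Fin n) (Fin n) ℂ}
    {F' : Matrix (Fin n) (Fin n) ℂ} {x : ℝ} (hx : 0 ≤ x) (h : HasDerivWithinAt F F' (Ici 0) x) :
    halfDeriv F x = F' :=
  h.derivWithin (uniqueDiffOn_Ici 0 x hx)

/-- `W` is a smooth extension of `V` to `[0, ∞)` with decaying derivatives. -/
structure IsExtension (r : ℝ) (V W : ℝ → Matrix (Fin n) (Fin n) ℂ) : Prop where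
  one_lt : 1 < r
  decay : SmoothDecay r W
  eq : ∀ x, 0 < x → W x = V x

theorem IsAdmissiblePotential.exists_isExtension (hV : IsAdmissiblePotential V) :
    ∃ r W, IsExtension r V W := by
  obtain ⟨r, h1, -, C, hC⟩ := hV.decay
  obtain ⟨W, hW, hWV⟩ := exists_smoothDecay_extension (r := r) (by linarith) hV.smooth (C := C)
    fun j x hx => by
      refine (hC j x hx).trans ?_
      have hCj : 0 ≤ C j := nonneg_of_mul_nonneg_left
        ((norm_nonneg _).trans (hC j x hx)) (by positivity)
      gcongr
      · linarith
      · simp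
  exact ⟨r, W, h1, hW, hWV⟩

theorem IsSolution.hasDeriv_fst {ψ : ℝ → Matrix (Fin n) (Fin n) ℂ} (h : IsSolution V k ψ) {x : ℝ}
    (hx : 0 ≤ x) : HasDerivWithinAt ψ (halfDeriv ψ x) (Ici 0) x :=
  (h.contDiffOn.differentiableOn (by simp) x hx).hasDerivWithinAt

theorem IsSolution.continuousOn_halfDeriv {ψ : ℝ → Matrix (Fin n) (Fin n) ℂ}
    (h : IsSolution V k ψ) : ContinuousOn (halfDeriv ψ) (Ici 0) :=
  h.contDiffOn.continuousOn_derivWithin (uniqueDiffOn_Ici 0) le_rfl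

theorem IsSolution.hasDeriv_snd {r : ℝ} (hW : IsExtension r V W)
    {ψ : ℝ → Matrix (Fin n) (Fin n) ℂ} (h : IsSolution V k ψ) {x : ℝ} (hx : 0 ≤ x) :
    HasDerivWithinAt (halfDeriv ψ) ((W x - k ^ 2 • 1) * ψ x) (Ici 0) x := by
  refine hasDerivWithinAt_of_hasDerivAt_Ioi h.continuousOn_halfDeriv (fun y hy => ?_)
    ((hW.decay.continuousOn.sub continuousOn_const).mul h.contDiffOn.continuousOn) hx
  refine (h.differentiableAt y hy).hasDerivAt.congr_deriv ?_
  have h1 := h.eqn y hy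
  change _ = (W y - k ^ 2 • 1) * ψ y
  rw [sub_mul, smul_mul_assoc, one_mul, hW.eq y hy, ← h1]
  abel

theorem isSolution_of_hasDeriv {r : ℝ} (hW : IsExtension r V W)
    {ψ χ : ℝ → Matrix (Fin n) (Fin n) ℂ}
    (h1 : ∀ x, 0 ≤ x → HasDerivWithinAt ψ (χ x) (Ici 0) x)
    (h2 : ∀ x, 0 ≤ x → HasDerivWithinAt χ ((W x - k ^ 2 • 1) * ψ x) (Ici 0) x) :
    IsSolution V k ψ ∧ EqOn (halfDeriv ψ) χ (Ici 0) := by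
  have heq : EqOn (halfDeriv ψ) χ (Ici 0) := fun x hx =>
    halfDeriv_eq_of_hasDerivWithinAt hx (h1 x hx)
  have hd : ∀ x, 0 < x → HasDerivAt (halfDeriv ψ) ((W x - k ^ 2 • 1) * ψ x) x := fun x hx =>
    ((h2 x hx.le).hasDerivAt (Ici_mem_nhds hx)).congr_of_eventuallyEq
      ((eventually_gt_nhds hx).mono fun y hy => heq (le_of_lt hy))
  refine ⟨⟨?_, fun x hx => (hd x hx).differentiableAt, fun x hx => ?_⟩, heq⟩
  · refine (contDiffOn_one_iff_derivWithin (uniqueDiffOn_Ici 0)).2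
      ⟨fun x hx => (h1 x hx).differentiableWithinAt, ?_⟩
    exact ContinuousOn.congr (fun x hx => (h2 x hx).continuousWithinAt) heq
  · rw [(hd x hx).deriv, sub_mul, smul_mul_assoc, one_mul, hW.eq x hx]
    abel

theorem norm_coeff_le {r : ℝ} (hW : IsExtension r V W) (k : ℂ) :
    ∃ K, ∀ x, 0 ≤ x → ‖W x - k ^ 2 • (1 : Matrix (Fin n) (Fin n) ℂ)‖ ≤ K := by
  obtain ⟨C, hC0, hC⟩ := hW.decay.exists_norm_le
  refine ⟨C + ‖k ^ 2 • (1 : Matrix (Fin n) (Fin n) ℂ)‖, fun x hx => (norm_sub_le _ _).trans ?_⟩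
  gcongr
  exact (hC x hx).trans (mul_le_of_le_one_right hC0.le
    (Real.rpow_le_one_of_one_le_of_nonpos (by linarith) (by linarith [hW.one_lt])))

theorem existsUnique_regularSolution {r : ℝ} (hW : IsExtension r V W)
    (A B : Matrix (Fin n) (Fin n) ℂ) (k : ℂ) :
    IsRegularSolution V A B k (regularSolution V A B k) ∧
      ∀ g, IsRegularSolution V A B k g → EqOn g (regularSolution V A B k) (Ici 0) := by
  obtain ⟨K, hK⟩ := norm_coeff_le hW k
  obtain ⟨ψ, χ, h0, h0', h1, h2⟩ := exists_linear_second_order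
    (hW.decay.continuousOn.sub continuousOn_const) hK A B
  obtain ⟨hs, heq⟩ := isSolution_of_hasDeriv hW h1 h2
  have hreg : IsRegularSolution V A B k (regularSolution V A B k) :=
    Classical.epsilon_spec ⟨ψ, hs, h0, (heq self_mem_Ici).trans h0'⟩
  refine ⟨hreg, fun g hg => ?_⟩
  refine eqOn_of_linear_second_order hK (fun x hx => hg.isSolution.hasDeriv_fst hx)
    (fun x hx => hg.isSolution.hasDeriv_snd hW hx)
    (fun x hx => hreg.isSolution.hasDeriv_fst hx)
    (fun x hx => hreg.isSolution.hasDeriv_snd hW hx) ?_ ?_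
  · rw [hg.init, hreg.init]
  · rw [hg.init_deriv, hreg.init_deriv]

theorem IsJostSolution.isNormalizedJost {r : ℝ} (hW : IsExtension r V W)
    {f : ℝ → Matrix (Fin n) (Fin n) ℂ} (hf : IsJostSolution V k f) :
    IsNormalizedJost W (2 * Complex.I * k) (fun x : ℝ => Complex.exp (-(Complex.I * k) * x) • f x)
      (fun x : ℝ =>
        Complex.exp (-(Complex.I * k) * x) • (halfDeriv f x - (Complex.I * k) • f x)) where
  hasDeriv_fst x hx := by
    refine ((hasDerivAt_cexp_mul_ofReal (-(Complex.I * k)) x).hasDerivWithinAt.smul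
      (hf.isSolution.hasDeriv_fst hx)).congr_deriv ?_
    module
  hasDeriv_snd x hx := by
    refine ((hasDerivAt_cexp_mul_ofReal (-(Complex.I * k)) x).hasDerivWithinAt.smul
      ((hf.isSolution.hasDeriv_snd hW hx).fun_sub
        ((hf.isSolution.hasDeriv_fst hx).fun_const_smul (Complex.I * k)))).congr_deriv ?_
    have hI : Complex.I ^ 2 = -1 := Complex.I_sq
    rw [sub_mul, smul_mul_assoc, one_mul, mul_smul_comm]
    match_scalars
    · ring
    · linear_combination -(Complex.exp (-(Complex.I * k) * x) * k ^ 2) * hI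
    · ring
  tendsto_fst := by
    have := hf.tendsto
    simpa only [neg_mul] using this
  tendsto_snd := by
    have := hf.tendsto_deriv.sub (hf.tendsto.const_smul (Complex.I * k))
    rw [sub_self] at this
    refine this.congr fun x => ?_
    rw [neg_mul, smul_sub, smul_comm]

theorem isJostSolution_of_isNormalizedJost {r : ℝ} (hW : IsExtension r V W)
    {u p : ℝ → Matrix (Fin n) (Fin n) ℂ} (h : IsNormalizedJost W (2 * Complex.I * k) u p) :
    IsJostSolution V k (fun x : ℝ => Complex.exp (Complex.I * k * x) • u x) := by
  have h1 : ∀ x : ℝ, 0 ≤ x → HasDerivWithinAt (fun x : ℝ => Complex.exp (Complex.I * k * x) • u x)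
      (Complex.exp (Complex.I * k * x) • (p x + (Complex.I * k) • u x)) (Ici 0) x := fun x hx => by
    refine ((hasDerivAt_cexp_mul_ofReal (Complex.I * k) x).hasDerivWithinAt.smul
      (h.hasDeriv_fst x hx)).congr_deriv ?_
    module
  have h2 : ∀ x : ℝ, 0 ≤ x → HasDerivWithinAt
      (fun x : ℝ => Complex.exp (Complex.I * k * x) • (p x + (Complex.I * k) • u x))
      ((W x - k ^ 2 • 1) * (Complex.exp (Complex.I * k * x) • u x)) (Ici 0) x := fun x hx => by
    refine ((hasDerivAt_cexp_mul_ofReal (Complex.I * k) x).hasDerivWithinAt.smul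
      ((h.hasDeriv_snd x hx).fun_add
        ((h.hasDeriv_fst x hx).fun_const_smul (Complex.I * k)))).congr_deriv ?_
    have hI : Complex.I ^ 2 = -1 := Complex.I_sq
    rw [sub_mul, smul_mul_assoc, one_mul, mul_smul_comm]
    match_scalars
    · ring
    · ring
    · linear_combination (Complex.exp (Complex.I * k * x) * k ^ 2) * hI
  obtain ⟨hs, heq⟩ := isSolution_of_hasDeriv hW h1 h2
  have hexp : ∀ x : ℝ, Complex.exp (-(Complex.I * k * x)) * Complex.exp (Complex.I * k * x) = 1 :=
    fun x => by rw [← Complex.exp_add, neg_add_cancel, Complex.exp_zero]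
  refine ⟨hs, h.tendsto_fst.congr fun x => ?_, ?_⟩
  · rw [smul_smul, hexp, one_smul]
  · have := h.tendsto_snd.add (h.tendsto_fst.const_smul (Complex.I * k))
    rw [zero_add] at this
    refine this.congr' ((eventually_ge_atTop 0).mono fun x hx => ?_)
    change _ = Complex.exp (-(Complex.I * k * x)) • halfDeriv _ x
    rw [heq hx, smul_smul, hexp, one_smul]

theorem re_two_I_mul (k : ℂ) : (2 * Complex.I * k).re = -(2 * k.im) := by
  simp

theorem existsUnique_jostSolution {r : ℝ} (hW : IsExtension r V W) (hk : 0 ≤ k.im) (hk0 : k ≠ 0) :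
    IsJostSolution V k (jostSolution V k) ∧
      ∀ g, IsJostSolution V k g → EqOn g (jostSolution V k) (Ici 0) := by
  obtain ⟨C, -, hC⟩ := hW.decay.exists_norm_le
  obtain ⟨⟨u, p, hup⟩, huniq⟩ := exists_isNormalizedJost (z := 2 * Complex.I * k) hW.one_lt
    hW.decay.continuousOn hC (by rw [re_two_I_mul]; linarith) (by simp [hk0])
  have hj : IsJostSolution V k (jostSolution V k) :=
    Classical.epsilon_spec ⟨_, isJostSolution_of_isNormalizedJost hW hup⟩
  refine ⟨hj, fun g hg x hx => ?_⟩
  have := huniq _ _ _ _ (hg.isNormalizedJost hW) (hj.isNormalizedJost hW) hx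
  exact smul_right_injective _ (Complex.exp_ne_zero _) this

end MatrixSolutions

section JostMatrix

variable {n : ℕ} {V W : ℝ → Matrix (Fin n) (Fin n) ℂ} {A B : Matrix (Fin n) (Fin n) ℂ} {k : ℂ}

/-! ### The Wronskian -/

theorem IsExtension.isHermitian (hV : IsAdmissiblePotential V) {r : ℝ} (hW : IsExtension r V W)
    {x : ℝ} (hx : 0 ≤ x) : (W x).conjTranspose = W x := by
  rcases hx.eq_or_lt with rfl | hx
  · have h1 : Tendsto W (𝓝[>] 0) (𝓝 (W 0)) :=
      ((hW.decay.continuousOn 0 self_mem_Ici).mono Ioi_subset_Ici_self).tendsto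
    have h2 : Tendsto (fun x => star (W x)) (𝓝[>] 0) (𝓝 (star (W 0))) := h1.star
    refine tendsto_nhds_unique (h2.congr' ?_) h1
    refine eventually_mem_nhdsWithin.mono fun y hy => ?_
    change (W y).conjTranspose = W y
    rw [hW.eq y hy, (hV.selfadjoint y hy).eq]
  · rw [hW.eq x hx, (hV.selfadjoint x hx).eq]

theorem hasDerivWithinAt_conjTranspose {F : ℝ → Matrix (Fin n) (Fin n) ℂ}
    {F' : Matrix (Fin n) (Fin n) ℂ} {x : ℝ} {s : Set ℝ} (h : HasDerivWithinAt F F' s x) :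
    HasDerivWithinAt (fun y => (F y).conjTranspose) F'.conjTranspose s x :=
  h.star

theorem neg_conj_im_nonneg (hk : 0 ≤ k.im) : 0 ≤ (-conj k).im := by simpa using hk

theorem neg_conj_ne_zero (hk : k ≠ 0) : -conj k ≠ 0 := by simpa using hk

theorem jostWronskian_eq {r : ℝ} (hW : IsExtension r V W) (hk : 0 ≤ k.im) (hk0 : k ≠ 0) {x : ℝ}
    (hx : 0 ≤ x) : jostWronskian V A B k x =
      (jostSolution V (-conj k) x).conjTranspose * halfDeriv (regularSolution V A B k) x
        - (halfDeriv (jostSolution V (-conj k)) x).conjTranspose * regularSolution V A B k x := by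
  have hf := (existsUnique_jostSolution hW (neg_conj_im_nonneg hk) (neg_conj_ne_zero hk0)).1
  have h := halfDeriv_eq_of_hasDerivWithinAt hx
    (hasDerivWithinAt_conjTranspose (hf.isSolution.hasDeriv_fst hx))
  rw [jostWronskian, wronskian, h]

theorem jostWronskian_eq_jostMatrix (hV : IsAdmissiblePotential V) {r : ℝ}
    (hW : IsExtension r V W) (hk : 0 ≤ k.im) (hk0 : k ≠ 0) {x : ℝ} (hx : 0 ≤ x) :
    jostWronskian V A B k x = jostMatrix V A B k := by
  have hf := (existsUnique_jostSolution hW (neg_conj_im_nonneg hk)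
    (neg_conj_ne_zero hk0)).1.isSolution
  have hφ := (existsUnique_regularSolution hW A B k).1.isSolution
  have hd : ∀ y, 0 ≤ y → HasDerivWithinAt (fun y =>
      (jostSolution V (-conj k) y).conjTranspose * halfDeriv (regularSolution V A B k) y
        - (halfDeriv (jostSolution V (-conj k)) y).conjTranspose * regularSolution V A B k y)
      0 (Ici 0) y := fun y hy => by
    refine (((hasDerivWithinAt_conjTranspose (hf.hasDeriv_fst hy)).mul
      (hφ.hasDeriv_snd hW hy)).fun_sub ((hasDerivWithinAt_conjTranspose
        (hf.hasDeriv_snd hW hy)).mul (hφ.hasDeriv_fst hy))).congr_deriv ?_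
    have hk2 : star ((-conj k) ^ 2) = k ^ 2 := by simp
    rw [Matrix.conjTranspose_mul, Matrix.conjTranspose_sub, hW.isHermitian hV hy,
      Matrix.conjTranspose_smul, Matrix.conjTranspose_one, hk2]
    noncomm_ring
  have h := constant_of_has_deriv_right_zero
    (fun y hy => ((hd y hy.1).continuousWithinAt).mono (Icc_subset_Ici_self : Icc 0 x ⊆ Ici 0))
    (fun y hy => (hd y hy.1).mono (Ici_subset_Ici.2 hy.1)) x ⟨hx, le_rfl⟩
  rw [jostMatrix, jostWronskian_eq hW hk hk0 hx, jostWronskian_eq hW hk hk0 le_rfl]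
  exact h

/-! ### The coefficients `b_l` -/

theorem isExpansionCoeff_bCoeff {r : ℝ} (hW : IsExtension r V W) :
    IsExpansionCoeff W (bCoeff V) where
  zero x _ := rfl
  succ l x hx := by
    have : ∫ y in Ioi x, W y * bCoeff V l y = ∫ y in Ioi x, V y * bCoeff V l y :=
      setIntegral_congr_fun measurableSet_Ioi fun y hy => by
        simp only [hW.eq y (hx.trans_lt hy)]
    rw [this]
    rfl

theorem bCoeff_smooth_integrable {r : ℝ} (hW : IsExtension r V W) (l : ℕ) :
    ContDiffOn ℝ ∞ (bCoeff V l) (Ici 0) ∧ IntegrableOn (fun y => V y * bCoeff V l y) (Ioi 0) := by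
  have h := (isExpansionCoeff_bCoeff hW).smoothDecay hW.one_lt hW.decay l
  refine ⟨h.1.smooth, ?_⟩
  have h2 : SmoothDecay r fun y => W y * bCoeff V l y := by simpa using hW.decay.mul h.1
  exact (h2.integrableOn hW.one_lt).congr_fun (fun y hy => by simp only [hW.eq y hy])
    measurableSet_Ioi

/-! ### Expansion of the Jost matrix -/

theorem eventually_atInftyUpper (R : ℝ) : ∀ᶠ k in atInftyUpper, R ≤ ‖k‖ ∧ 0 ≤ k.im :=
  ((tendsto_norm_cobounded_atTop.eventually_ge_atTop R).filter_mono inf_le_left).and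
    (eventually_inf_principal.2 (Eventually.of_forall fun _ h => h))

instance atInftyUpper_neBot : atInftyUpper.NeBot := by
  have h : Tendsto (fun t : ℝ => (t : ℂ) * Complex.I) atTop atInftyUpper := by
    refine tendsto_inf.2 ⟨tendsto_norm_atTop_iff_cobounded.1 ?_, tendsto_principal.2 ?_⟩
    · simpa using tendsto_abs_atTop_atTop
    · exact (eventually_ge_atTop 0).mono fun t ht => by simpa using ht
  exact h.neBot

theorem isBigO_zpow_of_le {a b : ℤ} (h : a ≤ b) :
    (fun k : ℂ => ‖k‖ ^ a) =O[atInftyUpper] fun k : ℂ => ‖k‖ ^ b := by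
  refine IsBigO.of_bound 1 ((eventually_atInftyUpper 1).mono fun k hk => ?_)
  rw [one_mul, Real.norm_of_nonneg (by positivity), Real.norm_of_nonneg (by positivity)]
  exact zpow_le_zpow_right₀ hk.1 h

theorem isBigO_two_I_mul_zpow (a : ℤ) :
    (fun k : ℂ => (2 * Complex.I * k) ^ a) =O[atInftyUpper] fun k : ℂ => ‖k‖ ^ a := by
  refine IsBigO.of_bound (2 ^ a) (Eventually.of_forall fun k => ?_)
  rw [norm_zpow, norm_mul, norm_mul, Complex.norm_I, mul_one, mul_zpow, norm_zpow, norm_norm]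
  simp

/-- The value `f(-k*, 0)†`, which is also the adjoint of the normalized Jost solution at `0`. -/
noncomputable def jostValue (V : ℝ → Matrix (Fin n) (Fin n) ℂ) (k : ℂ) : Matrix (Fin n) (Fin n) ℂ :=
  (jostSolution V (-conj k) 0).conjTranspose

/-- The matrix `f'(-k*, 0)† - ik f(-k*, 0)†`, the adjoint of the derivative at `0` of the normalized
Jost solution `e^{ik* x} f(-k*, x)`. -/
noncomputable def jostSlope (V : ℝ → Matrix (Fin n) (Fin n) ℂ) (k : ℂ) : Matrix (Fin n) (Fin n) ℂ :=
  (halfDeriv (jostSolution V (-conj k)) 0).conjTranspose - (Complex.I * k) • jostValue V k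

theorem jostMatrix_eq {r : ℝ} (hW : IsExtension r V W) (hk : 0 ≤ k.im) (hk0 : k ≠ 0) :
    jostMatrix V A B k = jostValue V k * B
      - (jostSlope V k + (Complex.I * k) • jostValue V k) * A := by
  have hφ := (existsUnique_regularSolution hW A B k).1
  rw [jostMatrix, jostWronskian_eq hW hk hk0 le_rfl, hφ.init, hφ.init_deriv, jostSlope,
    sub_add_cancel, jostValue]

/-- The expansion of the normalized Jost solution, transported to `f(-k*, 0)†`. Taking the adjoint
turns the variable `2i(-k*)` into `2ik`. -/
theorem norm_jostValue_jostSlope_sub_le {r : ℝ} (hW : IsExtension r V W) (L : ℕ) :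
    ∃ G : ℝ, ∀ᶠ k in atInftyUpper,
      ‖jostValue V k - ∑ l ∈ Finset.range (L + 1),
        (2 * Complex.I * k)⁻¹ ^ l • (bCoeff V l 0).conjTranspose‖ ≤ G * ‖k‖ ^ (-(L + 1 : ℤ)) ∧
      ‖jostSlope V k - ∑ l ∈ Finset.range (L + 1),
        (2 * Complex.I * k)⁻¹ ^ l • (halfDeriv (bCoeff V l) 0).conjTranspose‖
          ≤ G * ‖k‖ ^ (-(L : ℤ)) := by
  have hb := isExpansionCoeff_bCoeff hW
  set I₁ : ℝ := ∫ y in Ioi 0, ‖derivWithin (bCoeff V (L + 1)) (Ici 0) y‖ with hI₁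
  have hI0 : 0 ≤ I₁ := integral_nonneg fun _ => norm_nonneg _
  refine ⟨2 * I₁, ?_⟩
  filter_upwards [eventually_atInftyUpper (max 1 (2 * ∫ y in Ioi 0, ‖W y‖))] with k hk
  obtain ⟨hk1, him⟩ := hk
  have hk1' : 1 ≤ ‖k‖ := (le_max_left _ _).trans hk1
  have hk2 : 2 * ∫ y in Ioi 0, ‖W y‖ ≤ ‖k‖ := (le_max_right _ _).trans hk1
  have hkpos : 0 < ‖k‖ := by linarith
  have hk0 : k ≠ 0 := norm_pos_iff.1 hkpos
  set z : ℂ := 2 * Complex.I * (-conj k) with hz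
  have hzn : ‖z‖ = 2 * ‖k‖ := by simp [hz]
  have hzc : star z⁻¹ = (2 * Complex.I * k)⁻¹ := by
    rw [star_inv₀]
    congr 1
    simp [hz]
  have hf := (existsUnique_jostSolution hW (neg_conj_im_nonneg him) (neg_conj_ne_zero hk0)).1
  obtain ⟨h1, h2⟩ := hb.norm_jost_sub_le hW.one_lt hW.decay (z := z)
    (by rw [hz, re_two_I_mul]; linarith [neg_conj_im_nonneg him])
    (by simp [hz, hk0]) (by rw [hzn]; linarith) (hf.isNormalizedJost hW) L
  have hpow : ‖z‖⁻¹ ^ L ≤ ‖k‖ ^ (-(L : ℤ)) := by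
    rw [hzn, zpow_neg, zpow_natCast, inv_pow]
    gcongr
    linarith
  rw [← hI₁] at h1 h2
  simp only [Complex.ofReal_zero, mul_zero, Complex.exp_zero, one_smul] at h1 h2
  have e1 : jostValue V k - ∑ l ∈ Finset.range (L + 1),
      (2 * Complex.I * k)⁻¹ ^ l • (bCoeff V l 0).conjTranspose
      = star (jostSolution V (-conj k) 0 - ∑ l ∈ Finset.range (L + 1), z⁻¹ ^ l • bCoeff V l 0) := by
    rw [star_sub, star_sum]
    simp only [star_smul, star_pow, hzc]
    rfl
  have e2 : jostSlope V k - ∑ l ∈ Finset.range (L + 1),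
      (2 * Complex.I * k)⁻¹ ^ l • (halfDeriv (bCoeff V l) 0).conjTranspose
      = star (halfDeriv (jostSolution V (-conj k)) 0
        - (Complex.I * -conj k) • jostSolution V (-conj k) 0
        - ∑ l ∈ Finset.range (L + 1), z⁻¹ ^ l • derivWithin (bCoeff V l) (Ici 0) 0) := by
    have hc : star (Complex.I * -conj k) = Complex.I * k := by simp
    rw [star_sub, star_sub, star_sum, star_smul, hc]
    simp only [star_smul, star_pow, hzc]
    rfl
  rw [e1, e2, norm_star, norm_star]
  constructor
  · refine h1.trans ?_
    rw [neg_add, zpow_add₀ hkpos.ne', zpow_neg_one]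
    calc 4 * (‖z‖⁻¹ ^ L * I₁) / ‖z‖ = 2 * I₁ * (‖z‖⁻¹ ^ L * ‖k‖⁻¹) := by
          generalize ‖z‖⁻¹ ^ L = q
          rw [hzn]
          field_simp
          ring
      _ ≤ _ := by gcongr
  · refine h2.trans ?_
    calc 2 * (‖z‖⁻¹ ^ L * I₁) = 2 * I₁ * ‖z‖⁻¹ ^ L := by ring
      _ ≤ _ := by gcongr

theorem isBigO_inv_pow_smul (l : ℕ) (X : Matrix (Fin n) (Fin n) ℂ) :
    (fun k : ℂ => (2 * Complex.I * k)⁻¹ ^ l • X) =O[atInftyUpper]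
      fun k : ℂ => ‖k‖ ^ (-(l : ℤ)) := by
  have h := (isBigO_two_I_mul_zpow (-(l : ℤ))).smul
    (isBigO_refl (fun _ : ℂ => X) atInftyUpper)
  refine (h.trans (k := fun k : ℂ => ‖k‖ ^ (-(l : ℤ))) ?_).congr_left fun k => ?_
  · refine IsBigO.of_bound ‖X‖ (Eventually.of_forall fun k => ?_)
    rw [norm_smul, mul_comm]
  · rw [zpow_neg, zpow_natCast, inv_pow]

theorem isBigO_jostValue_sub {r : ℝ} (hW : IsExtension r V W) (L : ℕ) :
    (fun k => jostValue V k - ∑ l ∈ Finset.range (L + 1),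
        (2 * Complex.I * k)⁻¹ ^ l • (bCoeff V l 0).conjTranspose)
      =O[atInftyUpper] fun k : ℂ => ‖k‖ ^ (-(L + 1 : ℤ)) := by
  obtain ⟨G, hG⟩ := norm_jostValue_jostSlope_sub_le hW L
  refine IsBigO.of_bound G (hG.mono fun k hk => hk.1.trans (le_of_eq ?_))
  rw [Real.norm_of_nonneg (by positivity)]

/-- One term more of the expansion makes up for the order lost in the estimate of the slope. -/
theorem isBigO_jostSlope_sub {r : ℝ} (hW : IsExtension r V W) (L : ℕ) :
    (fun k => jostSlope V k - ∑ l ∈ Finset.range (L + 1),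
        (2 * Complex.I * k)⁻¹ ^ l • (halfDeriv (bCoeff V l) 0).conjTranspose)
      =O[atInftyUpper] fun k : ℂ => ‖k‖ ^ (-(L + 1 : ℤ)) := by
  obtain ⟨G, hG⟩ := norm_jostValue_jostSlope_sub_le hW (L + 1)
  have h1 : (fun k => jostSlope V k - ∑ l ∈ Finset.range (L + 1 + 1),
        (2 * Complex.I * k)⁻¹ ^ l • (halfDeriv (bCoeff V l) 0).conjTranspose)
      =O[atInftyUpper] fun k : ℂ => ‖k‖ ^ (-(L + 1 : ℤ)) := by
    refine IsBigO.of_bound G (hG.mono fun k hk => hk.2.trans (le_of_eq ?_))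
    rw [Real.norm_of_nonneg (by positivity)]
    push_cast
    rfl
  have h2 := isBigO_inv_pow_smul (L + 1) (halfDeriv (bCoeff V (L + 1)) 0).conjTranspose
  push_cast at h2
  refine (h1.add h2).congr_left fun k => ?_
  rw [Finset.sum_range_succ _ (L + 1)]
  abel

theorem isBigO_mul_const {F : ℂ → Matrix (Fin n) (Fin n) ℂ} {g : ℂ → ℝ}
    (X : Matrix (Fin n) (Fin n) ℂ) (hF : F =O[atInftyUpper] g) :
    (fun k => F k * X) =O[atInftyUpper] g :=
  (IsBigO.of_bound ‖X‖ (Eventually.of_forall fun _ => (norm_mul_le _ _).trans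
    (le_of_eq (mul_comm _ _)))).trans hF

/-- The formula for `c_l` with `l ≥ 1` holds for `c_0` too, since `b_0 = I` and `b_0' = 0`. -/
theorem cCoeff_natCast (l : ℕ) : cCoeff V A B (l : ℤ) = (bCoeff V l 0).conjTranspose * B
      - ((1 / 2 : ℂ) • (bCoeff V (l + 1) 0).conjTranspose
          + (halfDeriv (bCoeff V l) 0).conjTranspose) * A := by
  cases l with
  | zero =>
    have h0 : halfDeriv (bCoeff V 0) 0 = 0 :=
      halfDeriv_eq_of_hasDerivWithinAt le_rfl (hasDerivWithinAt_const _ _ _)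
    rw [h0]
    change B - (1 / 2 : ℂ) • ((bCoeff V 1 0).conjTranspose * A) = _
    simp [bCoeff]
  | succ l => rfl

theorem cCoeff_neg_one : cCoeff V A B (-1) = -((1 / 2 : ℂ) • A) := rfl

theorem sum_Icc_neg_one {M : Type*} [AddCommMonoid M] (f : ℤ → M) (L : ℕ) :
    ∑ l ∈ Finset.Icc (-1 : ℤ) L, f l = f (-1) + ∑ l ∈ Finset.range (L + 1), f l := by
  induction L with
  | zero =>
    have : Finset.Icc (-1 : ℤ) ((0 : ℕ) : ℤ) = {-1, 0} := rfl
    rw [this, Finset.sum_pair (by norm_num)]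
    simp
  | succ L ih =>
    have : Finset.Icc (-1 : ℤ) ((L + 1 : ℕ) : ℤ)
        = insert ((L + 1 : ℕ) : ℤ) (Finset.Icc (-1 : ℤ) L) := by
      ext x
      simp only [Finset.mem_Icc, Finset.mem_insert]
      omega
    rw [this, Finset.sum_insert (by simp), ih, Finset.sum_range_succ _ (L + 1)]
    abel

/-- The asymptotic expansion `J(k) ~ ∑_{l ≥ -1} c_l (2ik)⁻ˡ` of the Jost matrix. -/
theorem isBigO_jostMatrix_sub {r : ℝ} (hW : IsExtension r V W) (L : ℕ) :
    (fun k => jostMatrix V A B k - ∑ l ∈ Finset.Icc (-1 : ℤ) L,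
        (2 * Complex.I * k) ^ (-l) • cCoeff V A B l)
      =O[atInftyUpper] fun k : ℂ => ‖k‖ ^ (-(L + 1 : ℤ)) := by
  have hU := isBigO_jostValue_sub hW L
  have hU' := isBigO_jostValue_sub hW (L + 1)
  have hP := isBigO_jostSlope_sub hW L
  have hI : (fun k : ℂ => Complex.I * k) =O[atInftyUpper] fun k : ℂ => ‖k‖ ^ (1 : ℤ) :=
    IsBigO.of_bound 1 (Eventually.of_forall fun k => by simp)
  -- the factor `ik` costs one order, so the value is expanded one term further than the slope
  have h3 := (hI.smul hU').trans (k := fun k : ℂ => ‖k‖ ^ (-(L + 1 : ℤ))) (by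
    refine IsBigO.of_bound 1 ((eventually_atInftyUpper 1).mono fun k hk => ?_)
    have hk0 : ‖k‖ ≠ 0 := by linarith [hk.1]
    rw [smul_eq_mul, ← zpow_add₀ hk0, one_mul]
    push_cast
    rw [show (1 : ℤ) + -(L + 1 + 1) = -(L + 1) by ring])
  refine ((((isBigO_mul_const B hU).sub (isBigO_mul_const A hP)).sub (isBigO_mul_const A h3))).congr'
    ?_ EventuallyEq.rfl
  filter_upwards [eventually_atInftyUpper 1] with k hk
  have hk0 : k ≠ 0 := norm_pos_iff.1 (by linarith [hk.1])
  have hz0 : 2 * Complex.I * k ≠ 0 := by simp [hk0]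
  rw [jostMatrix_eq hW hk.2 hk0, sum_Icc_neg_one, cCoeff_neg_one]
  simp only [cCoeff_natCast, zpow_neg, zpow_natCast, inv_pow]
  rw [Finset.sum_range_succ' _ (L + 1)]
  have hb0 : (bCoeff V 0 0).conjTranspose = 1 := Matrix.conjTranspose_one
  have e1 : (Complex.I * k) • ∑ l ∈ Finset.range (L + 1),
      ((2 * Complex.I * k) ^ (l + 1))⁻¹ • (bCoeff V (l + 1) 0).conjTranspose
      = ∑ l ∈ Finset.range (L + 1), ((2 * Complex.I * k) ^ l)⁻¹ •
        (1 / 2 : ℂ) • (bCoeff V (l + 1) 0).conjTranspose := by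
    rw [Finset.smul_sum]
    refine Finset.sum_congr rfl fun l _ => ?_
    rw [smul_smul, smul_smul]
    congr 1
    rw [pow_succ]
    field_simp
  rw [hb0, smul_sub, smul_add, e1]
  simp only [smul_sub, smul_add, add_mul, sub_mul, Finset.sum_sub_distrib, Finset.sum_add_distrib,
    Finset.sum_mul, smul_mul_assoc, one_mul]
  match_scalars <;> field_simp

end JostMatrix

/-! ### Diagonal representation of the boundary matrices -/

section Diagonal

variable {n : ℕ} {A B : Matrix (Fin n) (Fin n) ℂ}

theorem IsBoundaryPair.det_add_I_smul_ne_zero (h : IsBoundaryPair A B) :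
    (B + Complex.I • A).det ≠ 0 := by
  have h1 : (B + Complex.I • A).conjTranspose * (B + Complex.I • A)
      = A.conjTranspose * A + B.conjTranspose * B := by
    have h2 : A.conjTranspose * B = B.conjTranspose * A := by
      have := h.symm
      rwa [neg_add_eq_zero, eq_comm] at this
    rw [Matrix.conjTranspose_add, Matrix.conjTranspose_smul, add_mul, mul_add, mul_add,
      smul_mul_assoc, smul_mul_assoc, mul_smul_comm, mul_smul_comm, h2]
    match_scalars <;> simp
  intro h0
  have h3 := h.pos.det_pos
  rw [← h1, Matrix.det_mul, h0, mul_zero] at h3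
  exact lt_irrefl _ h3

/-- `det (B + t A)` is a polynomial in `t` that does not vanish at `t = i`, so it does not vanish
at some real `t`. -/
theorem IsBoundaryPair.exists_real_det_ne_zero (h : IsBoundaryPair A B) :
    ∃ t : ℝ, (B + (t : ℂ) • A).det ≠ 0 := by
  let q : Polynomial ℂ :=
    (B.map Polynomial.C + (Polynomial.X : Polynomial ℂ) • A.map Polynomial.C).det
  have hq : ∀ t : ℂ, q.eval t = (B + t • A).det := fun t => by
    change Polynomial.evalRingHom t q = _
    rw [RingHom.map_det]
    congr 1
    ext i j
    simp only [RingHom.mapMatrix_apply, Matrix.map_apply, Matrix.add_apply, Matrix.smul_apply,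
      smul_eq_mul, map_add, Polynomial.coe_evalRingHom, Polynomial.eval_mul,
      Polynomial.eval_X, Polynomial.eval_C]
  have hq0 : q ≠ 0 := fun h0 => h.det_add_I_smul_ne_zero (by rw [← hq, h0, Polynomial.eval_zero])
  by_contra! hall
  refine hq0 (Polynomial.eq_zero_of_infinite_isRoot q ?_)
  refine (Set.infinite_range_of_injective Complex.ofReal_injective).mono ?_
  rintro _ ⟨t, rfl⟩
  rw [Set.mem_ofPred_eq, Polynomial.IsRoot, hq, hall t]

/-- Polar coordinates for a real line through the origin, with the angle in `(0, π]`. -/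
theorem exists_polar {a b : ℝ} (h : a ≠ 0 ∨ b ≠ 0) :
    ∃ r θ : ℝ, r ≠ 0 ∧ θ ∈ Ioc 0 Real.pi ∧ a = -(Real.sin θ * r) ∧ b = Real.cos θ * r := by
  have key : ∀ a b : ℝ, a < 0 →
      ∃ r θ : ℝ, r ≠ 0 ∧ θ ∈ Ioc 0 Real.pi ∧ a = -(Real.sin θ * r) ∧ b = Real.cos θ * r := by
    intro a b ha
    set z : ℂ := ⟨b, -a⟩ with hz
    have hz0 : z ≠ 0 := fun h0 => by
      have := congrArg Complex.im h0
      simp only [hz, Complex.zero_im] at this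
      linarith
    have h1 : ‖z‖ * Real.sin z.arg = -a := by
      simp [hz]
    have h2 : ‖z‖ * Real.cos z.arg = b := by
      simp [hz]
    refine ⟨‖z‖, z.arg, norm_ne_zero_iff.2 hz0, ⟨?_, Complex.arg_le_pi z⟩, by linarith, by linarith⟩
    refine lt_of_le_of_ne (Complex.arg_nonneg_iff.2 (by simp only [hz]; linarith)) fun h0 => ?_
    rw [← h0, Real.sin_zero] at h1
    linarith
  rcases lt_trichotomy a 0 with ha | ha | ha
  · exact key a b ha
  · refine ⟨-b, Real.pi, ?_, ⟨Real.pi_pos, le_rfl⟩, by simp [ha], by simp⟩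
    rcases h with h | h
    · exact absurd ha h
    · exact neg_ne_zero.2 h
  · obtain ⟨r, θ, hr, hθ, h1, h2⟩ := key (-a) (-b) (by linarith)
    exact ⟨-r, θ, neg_ne_zero.2 hr, hθ, by linarith, by linarith⟩

/-- With `X = B + tA` invertible for a real `t`, the matrix `H = A X⁻¹` is Hermitian, and
diagonalizing it diagonalizes both `A X⁻¹ = H` and `B X⁻¹ = 1 - tH`. -/
theorem IsBoundaryPair.exists_isDiagonalRepresentation (h : IsBoundaryPair A B) :
    ∃ (θ : Fin n → ℝ) (M T₁ T₂ : Matrix (Fin n) (Fin n) ℂ),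
      IsDiagonalRepresentation A B θ M T₁ T₂ := by
  obtain ⟨t, ht⟩ := h.exists_real_det_ne_zero
  set X := B + (t : ℂ) • A with hX
  have hXu : IsUnit X.det := isUnit_iff_ne_zero.2 ht
  have h2 : A.conjTranspose * B = B.conjTranspose * A := by
    have := h.symm
    rwa [neg_add_eq_zero, eq_comm] at this
  have hXA : X.conjTranspose * A = A.conjTranspose * X := by
    rw [hX, Matrix.conjTranspose_add, Matrix.conjTranspose_smul, add_mul, mul_add, h2,
      smul_mul_assoc, mul_smul_comm]
    simp
  set H := A * X⁻¹ with hHdef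
  have hHX : H * X = A := by rw [hHdef, mul_assoc, Matrix.nonsing_inv_mul _ hXu, mul_one]
  have hXu' : IsUnit X.conjTranspose.det := by
    rw [Matrix.det_conjTranspose]
    exact hXu.star
  have hH : H.IsHermitian := by
    rw [Matrix.IsHermitian, hHdef, Matrix.conjTranspose_mul, Matrix.conjTranspose_nonsing_inv]
    calc X.conjTranspose⁻¹ * A.conjTranspose
        = X.conjTranspose⁻¹ * (A.conjTranspose * X) * X⁻¹ := by
          rw [mul_assoc, mul_assoc, Matrix.mul_nonsing_inv _ hXu, mul_one]
      _ = A * X⁻¹ := by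
          rw [← hXA, ← mul_assoc, Matrix.nonsing_inv_mul _ hXu', one_mul]
  let M : Matrix (Fin n) (Fin n) ℂ := hH.eigenvectorUnitary
  have hMu : M ∈ Matrix.unitaryGroup (Fin n) ℂ := hH.eigenvectorUnitary.2
  have hMM : M * M.conjTranspose = 1 := Matrix.mem_unitaryGroup_iff.1 hMu
  have hspec : H = M * Matrix.diagonal (fun j => (hH.eigenvalues j : ℂ)) * M.conjTranspose := by
    have := hH.spectral_theorem
    rwa [Unitary.conjStarAlgAut_apply] at this
  have hpol : ∀ j, ∃ r θ : ℝ, r ≠ 0 ∧ θ ∈ Ioc 0 Real.pi ∧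
      hH.eigenvalues j = -(Real.sin θ * r) ∧ 1 - t * hH.eigenvalues j = Real.cos θ * r := fun j =>
    exists_polar (by
      by_contra! h0
      rw [h0.1] at h0
      norm_num at h0)
  choose r θ hr hθ hsin hcos using hpol
  have hA : diagA θ * Matrix.diagonal (fun j => (r j : ℂ))
      = Matrix.diagonal (fun j => (hH.eigenvalues j : ℂ)) := by
    rw [diagA, neg_mul, Matrix.diagonal_mul_diagonal, Matrix.diagonal_neg]
    congr 1
    funext j
    rw [hsin j]
    push_cast
    rfl
  have hB : diagB θ * Matrix.diagonal (fun j => (r j : ℂ))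
      = 1 - (t : ℂ) • Matrix.diagonal (fun j => (hH.eigenvalues j : ℂ)) := by
    rw [diagB, Matrix.diagonal_mul_diagonal, ← Matrix.diagonal_one, ← Matrix.diagonal_smul,
      Matrix.diagonal_sub]
    congr 1
    funext j
    have := congrArg (fun x : ℝ => (x : ℂ)) (hcos j)
    push_cast at this
    simpa using this.symm
  have hAeq : A = M * diagA θ * Matrix.diagonal (fun j => (r j : ℂ)) * M.conjTranspose * X := by
    rw [mul_assoc M, hA, ← hspec, hHX]
  refine ⟨θ, M, X, Matrix.diagonal fun j => (r j : ℂ), hθ, hMu,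
    (Matrix.isUnit_iff_isUnit_det _).2 hXu, ?_, hAeq, ?_⟩
  · rw [Matrix.isUnit_iff_isUnit_det, Matrix.det_diagonal, isUnit_iff_ne_zero]
    exact Finset.prod_ne_zero_iff.2 fun j _ => by exact_mod_cast hr j
  · rw [mul_assoc M, hB, mul_sub, sub_mul, sub_mul, mul_one, hMM, one_mul, mul_smul_comm,
      smul_mul_assoc, ← hspec, smul_mul_assoc, hHX, hX, add_sub_cancel_right]

end Diagonal

/-! ### Asymptotics of determinants -/

section Det

variable {α : Type*} {f : Filter α}

theorem isBigO_prod_sub_prod {ι : Type*} {X Y : ι → α → ℂ} {h e : α → ℝ} (s : Finset ι)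
    (hX : ∀ i, X i =O[f] h) (hY : ∀ i, Y i =O[f] h)
    (hXY : ∀ i, (fun a => X i a - Y i a) =O[f] fun a => h a * e a) :
    (fun a => ∏ i ∈ s, X i a - ∏ i ∈ s, Y i a) =O[f] fun a => h a ^ s.card * e a := by
  classical
  induction s using Finset.induction_on with
  | empty => simpa using isBigO_zero _ _
  | insert i s hi ih =>
    have h2 : (fun a => ∏ j ∈ s, X j a) =O[f] fun a => h a ^ s.card := by
      simpa using IsBigO.finsetProd (s := s) (fun j _ => hX j)
    have h1 := ((hXY i).mul h2).congr_right (g₂ := fun a => h a ^ (s.card + 1) * e a)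
      fun a => by ring
    have h3 := ((hY i).mul ih).congr_right (g₂ := fun a => h a ^ (s.card + 1) * e a)
      fun a => by ring
    rw [Finset.card_insert_of_notMem hi]
    refine (h1.add h3).congr_left fun a => ?_
    rw [Finset.prod_insert hi, Finset.prod_insert hi]
    ring

/-- Determinants of matrices of size `O(h)` that differ by `O(h e)` differ by `O(hⁿ e)`. -/
theorem isBigO_det_sub_det {n : ℕ} {X Y : α → Matrix (Fin n) (Fin n) ℂ} {h e : α → ℝ}
    (hX : X =O[f] h) (hY : Y =O[f] h) (hXY : (fun a => X a - Y a) =O[f] fun a => h a * e a) :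
    (fun a => (X a).det - (Y a).det) =O[f] fun a => h a ^ n * e a := by
  have entry : ∀ {Z : α → Matrix (Fin n) (Fin n) ℂ} {g : α → ℝ} (i j : Fin n), Z =O[f] g →
      (fun a => Z a i j) =O[f] g := fun {Z g} i j hZ =>
    (ContinuousLinearMap.isBigO_comp
      (LinearMap.toContinuousLinearMap (Matrix.entryLinearMap ℂ ℂ i j)) Z f).trans hZ
  have h1 : ∀ σ : Equiv.Perm (Fin n), (fun a => ((Equiv.Perm.sign σ : ℤ) : ℂ) *
      (∏ i, X a (σ i) i - ∏ i, Y a (σ i) i)) =O[f] fun a => h a ^ n * e a := fun σ => by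
    have := isBigO_prod_sub_prod (X := fun i a => X a (σ i) i) (Y := fun i a => Y a (σ i) i)
      Finset.univ (fun i => entry _ _ hX) (fun i => entry _ _ hY) (fun i => entry _ _ hXY)
    rw [Finset.card_univ, Fintype.card_fin] at this
    exact this.const_mul_left _
  refine (IsBigO.fun_sum fun σ (_ : σ ∈ Finset.univ) => h1 σ).congr_left fun a => ?_
  simp only [Matrix.det_apply', ← Finset.sum_sub_distrib, mul_sub]

end Det

section DetExpansion

variable {n : ℕ} {V W : ℝ → Matrix (Fin n) (Fin n) ℂ} {A B : Matrix (Fin n) (Fin n) ℂ}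

theorem prod_zpow_eq_zpow_sum {ι : Type*} (s : Finset ι) (t : ι → ℤ) {z : ℂ} (hz : z ≠ 0) :
    ∏ i ∈ s, z ^ t i = z ^ ∑ i ∈ s, t i := by
  classical
  induction s using Finset.induction_on with
  | empty => simp
  | insert i s hi ih => rw [Finset.prod_insert hi, Finset.sum_insert hi, zpow_add₀ hz, ih]

/-- The contribution of an index tuple to the coefficient `d_l`. -/
noncomputable def tupleTerm (V : ℝ → Matrix (Fin n) (Fin n) ℂ) (A B : Matrix (Fin n) (Fin n) ℂ)
    (t : Fin n → ℤ) : ℂ :=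
  ∑ σ : Equiv.Perm (Fin n), ((Equiv.Perm.sign σ : ℤ) : ℂ) * ∏ i, cCoeff V A B (t i) i (σ i)

theorem dCoeff_eq_sum_tupleTerm (l : ℤ) :
    dCoeff V A B l = ∑ t ∈ indexTuples n l, tupleTerm V A B t := by
  simp only [dCoeff, tupleTerm, Finset.mul_sum]
  rw [Finset.sum_comm]

theorem det_sum_zpow_smul {z : ℂ} (hz : z ≠ 0) (s : Finset ℤ) :
    (∑ l ∈ s, z ^ (-l) • cCoeff V A B l).det
      = ∑ t ∈ Fintype.piFinset fun _ : Fin n => s, z ^ (-∑ i, t i) * tupleTerm V A B t := by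
  rw [← Matrix.det_transpose, Matrix.det_apply']
  simp only [Matrix.transpose_apply, Matrix.sum_apply, Matrix.smul_apply, smul_eq_mul,
    Finset.prod_univ_sum, Finset.prod_mul_distrib, prod_zpow_eq_zpow_sum _ _ hz,
    Finset.sum_neg_distrib, tupleTerm, Finset.mul_sum]
  rw [Finset.sum_comm]
  refine Finset.sum_congr rfl fun t _ => Finset.sum_congr rfl fun σ _ => ?_
  ring

/-- The tuples with entries in `[-1, L]` and sum at most `N` are all the tuples with entries
`≥ -1` and sum at most `N` once `N + n - 1 ≤ L`. -/
theorem sum_piFinset_filter_le (N : ℤ) (L : ℕ) (hL : N + n - 1 ≤ L) (z : ℂ) :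
    ∑ t ∈ (Fintype.piFinset fun _ : Fin n => Finset.Icc (-1 : ℤ) L) with ∑ i, t i ≤ N,
        z ^ (-∑ i, t i) * tupleTerm V A B t
      = ∑ l ∈ Finset.Icc (-(n : ℤ)) N, dCoeff V A B l * z ^ (-l) := by
  have hmaps : ∀ t ∈ (Fintype.piFinset fun _ : Fin n => Finset.Icc (-1 : ℤ) L).filter
      (fun t => ∑ i, t i ≤ N), ∑ i, t i ∈ Finset.Icc (-(n : ℤ)) N := fun t ht => by
    rw [Finset.mem_filter, Fintype.mem_piFinset] at ht
    refine Finset.mem_Icc.2 ⟨?_, ht.2⟩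
    have := Finset.sum_le_sum fun i (_ : i ∈ Finset.univ) => (Finset.mem_Icc.1 (ht.1 i)).1
    simpa using this
  rw [← Finset.sum_fiberwise_of_maps_to hmaps]
  refine Finset.sum_congr rfl fun l hl => ?_
  rw [dCoeff_eq_sum_tupleTerm, Finset.sum_mul]
  have hset : ((Fintype.piFinset fun _ : Fin n => Finset.Icc (-1 : ℤ) L).filter
      (fun t => ∑ i, t i ≤ N)).filter (fun t => ∑ i, t i = l) = indexTuples n l := by
    ext t
    have hlN := (Finset.mem_Icc.1 hl).2
    simp only [indexTuples, Finset.mem_filter, Fintype.mem_piFinset]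
    refine ⟨fun h => ⟨fun i => ?_, h.2⟩, fun h => ⟨⟨fun i => ?_, by rw [h.2]; exact hlN⟩, h.2⟩⟩
    · have := ((mem_indexTuples n l t).2 ⟨fun i => (Finset.mem_Icc.1 (h.1.1 i)).1, h.2⟩)
      rw [indexTuples, Finset.mem_filter, Fintype.mem_piFinset] at this
      exact this.1 i
    · have := Finset.mem_Icc.1 (h.1 i)
      exact Finset.mem_Icc.2 ⟨this.1, by linarith⟩
  rw [hset]
  refine Finset.sum_congr rfl fun t ht => ?_
  rw [((mem_indexTuples n l t).1 ht).2, mul_comm]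

/-- The expansion of `det J(k)`, with all powers from `(2ik)ⁿ` on. -/
theorem isBigO_det_jostMatrix_sub {r : ℝ} (hW : IsExtension r V W) (N : ℤ) :
    (fun k => (jostMatrix V A B k).det
        - ∑ l ∈ Finset.Icc (-(n : ℤ)) N, dCoeff V A B l * (2 * Complex.I * k) ^ (-l))
      =O[atInftyUpper] fun k : ℂ => ‖k‖ ^ (-(N + 1)) := by
  obtain ⟨L, hL⟩ : ∃ L : ℕ, N + n - 1 ≤ L := ⟨(N + n - 1).toNat, Int.self_le_toNat _⟩
  -- with this `L` the error of order `|k|^{-L-1}` in one factor, times `|k|^{n-1}` from the other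
  -- `n - 1` factors, is negligible
  let S : ℂ → Matrix (Fin n) (Fin n) ℂ := fun k =>
    ∑ l ∈ Finset.Icc (-1 : ℤ) L, (2 * Complex.I * k) ^ (-l) • cCoeff V A B l
  have hJS := isBigO_jostMatrix_sub (A := A) (B := B) hW L
  have hS : S =O[atInftyUpper] fun k : ℂ => ‖k‖ ^ (1 : ℤ) := by
    refine IsBigO.fun_sum fun l hl => ?_
    have h1 : (-l : ℤ) ≤ 1 := by linarith [(Finset.mem_Icc.1 hl).1]
    have h2 := ((isBigO_two_I_mul_zpow (-l)).trans (isBigO_zpow_of_le h1)).smul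
      (isBigO_refl (fun _ : ℂ => cCoeff V A B l) atInftyUpper)
    refine h2.trans (IsBigO.of_bound ‖cCoeff V A B l‖ (Eventually.of_forall fun k => ?_))
    rw [norm_smul, mul_comm]
  have hJ : (fun k => jostMatrix V A B k) =O[atInftyUpper] fun k : ℂ => ‖k‖ ^ (1 : ℤ) :=
    ((hJS.trans (isBigO_zpow_of_le (by omega))).add hS).congr_left fun k => sub_add_cancel _ _
  have hk0 : ∀ᶠ k in atInftyUpper, ‖k‖ ≠ 0 :=
    (eventually_atInftyUpper 1).mono fun k hk => by linarith [hk.1]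
  have h1 : (fun k => (jostMatrix V A B k).det - (S k).det)
      =O[atInftyUpper] fun k : ℂ => ‖k‖ ^ (-(N + 1)) := by
    have h2 := isBigO_det_sub_det (e := fun k : ℂ => ‖k‖ ^ (-(L + 2 : ℤ))) hJ hS
      (hJS.trans_eventuallyEq (hk0.mono fun k hk => by
        simp only [← zpow_add₀ hk]
        congr 1))
    refine (h2.trans_eventuallyEq (g₂ := fun k : ℂ => ‖k‖ ^ (n - (L + 2) : ℤ))
      (hk0.mono fun k hk => ?_)).trans (isBigO_zpow_of_le (by omega))
    simp only [zpow_one, ← zpow_natCast, ← zpow_add₀ hk]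
    rfl
  have h3 : (fun k => (S k).det
        - ∑ l ∈ Finset.Icc (-(n : ℤ)) N, dCoeff V A B l * (2 * Complex.I * k) ^ (-l))
      =O[atInftyUpper] fun k : ℂ => ‖k‖ ^ (-(N + 1)) := by
    have h4 : (fun k : ℂ => ∑ t ∈ (Fintype.piFinset fun _ : Fin n => Finset.Icc (-1 : ℤ) L) with
        ¬ ∑ i, t i ≤ N, (2 * Complex.I * k) ^ (-∑ i, t i) * tupleTerm V A B t)
        =O[atInftyUpper] fun k : ℂ => ‖k‖ ^ (-(N + 1)) := by
      refine IsBigO.fun_sum fun t ht => ?_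
      have h5 := (Finset.mem_filter.1 ht).2
      have h6 := (isBigO_two_I_mul_zpow (-∑ i, t i)).trans
        (isBigO_zpow_of_le (b := -(N + 1)) (by omega))
      simpa [mul_comm] using h6.const_mul_left (tupleTerm V A B t)
    refine h4.congr' ?_ EventuallyEq.rfl
    filter_upwards [hk0] with k hk
    have hz : 2 * Complex.I * k ≠ 0 := by simp [norm_ne_zero_iff.1 hk]
    rw [det_sum_zpow_smul hz, ← sum_piFinset_filter_le N L hL, eq_sub_iff_add_eq',
      Finset.sum_filter_add_sum_filter_not]
  exact (h1.add h3).congr_left fun k => sub_add_sub_cancel _ _ _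

end DetExpansion

/-! ### The leading coefficient -/

section Leading

variable {n : ℕ} {V W : ℝ → Matrix (Fin n) (Fin n) ℂ} {A B : Matrix (Fin n) (Fin n) ℂ}
  {θ : Fin n → ℝ} {M T₁ T₂ : Matrix (Fin n) (Fin n) ℂ}

theorem numMixed_add_numNeumann (θ : Fin n → ℝ) :
    numMixed θ + numNeumann θ = (Finset.univ.filter fun j => θ j ≠ Real.pi).card := by
  simp only [numMixed, numNeumann, Finset.card_filter, ← Finset.sum_add_distrib]
  refine Finset.sum_congr rfl fun j _ => ?_
  have hpi : Real.pi / 2 ≠ Real.pi := by linarith [Real.pi_pos]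
  by_cases h1 : θ j = Real.pi / 2
  · simp [h1, hpi]
  · simp [h1]

theorem numMixed_add_numNeumann_le (θ : Fin n → ℝ) : numMixed θ + numNeumann θ ≤ n := by
  rw [numMixed_add_numNeumann]
  exact (Finset.card_filter_le _ _).trans (by simp)

theorem isBigO_jostValue_sub_one {r : ℝ} (hW : IsExtension r V W) :
    (fun k => jostValue V k - 1) =O[atInftyUpper] fun k : ℂ => ‖k‖ ^ (-1 : ℤ) := by
  have hb0 : (bCoeff V 0 0).conjTranspose = 1 := Matrix.conjTranspose_one
  simpa [hb0] using isBigO_jostValue_sub hW 0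

theorem isBigO_jostSlope {r : ℝ} (hW : IsExtension r V W) :
    jostSlope V =O[atInftyUpper] fun k : ℂ => ‖k‖ ^ (-1 : ℤ) := by
  have h0 : halfDeriv (bCoeff V 0) 0 = 0 :=
    halfDeriv_eq_of_hasDerivWithinAt le_rfl (hasDerivWithinAt_const _ _ _)
  simpa [h0] using isBigO_jostSlope_sub hW 0

/-- `det J(k) = c₂ k^p (1 + O(1/k))` with `p` the number of conditions that are not Dirichlet.
Up to an invertible right factor the columns of `J(k)` are `-M e_j + O(1/k)` for a Dirichlet
condition and `ik sin θ_j (M e_j + O(1/k))` otherwise. -/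
theorem exists_det_jostMatrix_leading {r : ℝ} (hW : IsExtension r V W)
    (hrep : IsDiagonalRepresentation A B θ M T₁ T₂) :
    ∃ c : ℂ, c ≠ 0 ∧ (fun k => (jostMatrix V A B k).det - c * k ^ (numMixed θ + numNeumann θ))
      =O[atInftyUpper] fun k : ℂ => ‖k‖ ^ ((numMixed θ + numNeumann θ : ℕ) - 1 : ℤ) := by
  set p := numMixed θ + numNeumann θ with hp
  have hsin : ∀ j, θ j ≠ Real.pi → Real.sin (θ j) ≠ 0 := fun j hj =>
    (Real.sin_pos_of_pos_of_lt_pi (hrep.angles j).1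
      (lt_of_le_of_ne (hrep.angles j).2 hj)).ne'
  let T := T₂ * M.conjTranspose * T₁
  have hM : M.det ≠ 0 := (Matrix.UnitaryGroup.det_isUnit ⟨M, hrep.unitary⟩).ne_zero
  have hT : T.det ≠ 0 := by
    simp only [T, Matrix.det_mul, Matrix.det_conjTranspose]
    exact mul_ne_zero (mul_ne_zero ((Matrix.isUnit_iff_isUnit_det _).1 hrep.isUnit₂).ne_zero
      (star_ne_zero.2 hM)) ((Matrix.isUnit_iff_isUnit_det _).1 hrep.isUnit₁).ne_zero
  let s : Fin n → ℂ := fun j => if θ j = Real.pi then -1 else Complex.I * Real.sin (θ j)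
  have hs : ∏ j, s j ≠ 0 := Finset.prod_ne_zero_iff.2 fun j _ => by
    simp only [s]
    split_ifs with h
    · simp
    · exact mul_ne_zero Complex.I_ne_zero (by exact_mod_cast hsin j h)
  -- the limits of the diagonal factors, and the first order correction of the one that carries `B`
  let E₁ : Matrix (Fin n) (Fin n) ℂ := Matrix.diagonal fun j => if θ j = Real.pi then 1 else 0
  let E₂ : Matrix (Fin n) (Fin n) ℂ := Matrix.diagonal fun j => if θ j = Real.pi then 0 else 1
  let F : Matrix (Fin n) (Fin n) ℂ := Matrix.diagonal fun j =>
    if θ j = Real.pi then 0 else (Real.cos (θ j) : ℂ) / Real.sin (θ j)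
  let D : ℂ → Matrix (Fin n) (Fin n) ℂ := fun k =>
    Matrix.diagonal fun j => if θ j = Real.pi then -1 else Complex.I * k * Real.sin (θ j)
  let X : ℂ → Matrix (Fin n) (Fin n) ℂ := fun k =>
    jostValue V k * M * (E₁ + (Complex.I * k)⁻¹ • F)
      + (jostValue V k + (Complex.I * k)⁻¹ • jostSlope V k) * M * E₂
  have hE : E₁ + E₂ = 1 := by
    simp only [E₁, E₂, Matrix.diagonal_add]
    rw [← Matrix.diagonal_one]
    congr 1
    funext j
    split_ifs <;> simp
  have hED : ∀ k, k ≠ 0 → (E₁ + (Complex.I * k)⁻¹ • F) * D k = diagB θ := fun k hk => by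
    simp only [E₁, F, D, diagB, ← Matrix.diagonal_smul, Matrix.diagonal_add,
      Matrix.diagonal_mul_diagonal]
    congr 1
    funext j
    by_cases h : θ j = Real.pi
    · simp [h]
    · have := hsin j h
      have h' : (Real.sin (θ j) : ℂ) ≠ 0 := by exact_mod_cast this
      simp only [if_neg h, Pi.smul_apply, smul_eq_mul, zero_add]
      field_simp
  have hED₂ : ∀ k, E₂ * D k = -((Complex.I * k) • diagA θ) := fun k => by
    simp only [E₂, D, diagA, Matrix.diagonal_mul_diagonal, smul_neg, neg_neg,
      ← Matrix.diagonal_smul]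
    congr 1
    funext j
    by_cases h : θ j = Real.pi
    · simp [h]
    · simp [h]
  have hJ : ∀ k, 0 ≤ k.im → k ≠ 0 → jostMatrix V A B k = X k * D k * T := fun k hk hk0 => by
    have hI : Complex.I * k ≠ 0 := mul_ne_zero Complex.I_ne_zero hk0
    have hA : A = M * diagA θ * T := by rw [hrep.eqA]; simp only [T, mul_assoc]
    have hB : B = M * diagB θ * T := by rw [hrep.eqB]; simp only [T, mul_assoc]
    have h1 : X k * D k = jostValue V k * M * diagB θ
        - (jostSlope V k + (Complex.I * k) • jostValue V k) * M * diagA θ := by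
      simp only [X]
      rw [add_mul, mul_assoc _ _ (D k), hED k hk0, mul_assoc _ E₂, hED₂, mul_neg, ← sub_eq_add_neg,
        mul_smul_comm, ← smul_mul_assoc, ← smul_mul_assoc, smul_add, smul_inv_smul₀ hI,
        add_comm (jostSlope V k)]
    rw [jostMatrix_eq hW hk hk0, h1, sub_mul]
    nth_rewrite 1 [hA, hB]
    simp only [mul_assoc]
  have hD : ∀ k, (D k).det = (∏ j, s j) * k ^ p := fun k => by
    have h1 : k ^ p = ∏ j, if θ j ≠ Real.pi then k else 1 := by
      rw [hp, numMixed_add_numNeumann, ← Finset.prod_filter, Finset.prod_const]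
    simp only [D, Matrix.det_diagonal]
    rw [h1, ← Finset.prod_mul_distrib]
    refine Finset.prod_congr rfl fun j _ => ?_
    by_cases h : θ j = Real.pi
    · simp [s, h]
    · simp only [s, h, if_false, ne_eq, not_false_eq_true, if_true]
      ring
  have hU1 := isBigO_jostValue_sub_one hW
  have hone : ∀ Y : Matrix (Fin n) (Fin n) ℂ,
      (fun _ : ℂ => Y) =O[atInftyUpper] fun _ : ℂ => (1 : ℝ) := fun Y =>
    isBigO_const_const Y one_ne_zero _
  have hk1 : (fun k : ℂ => ‖k‖ ^ (-1 : ℤ)) =O[atInftyUpper] fun _ : ℂ => (1 : ℝ) := by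
    simpa using isBigO_zpow_of_le (show (-1 : ℤ) ≤ 0 by norm_num)
  have hU : jostValue V =O[atInftyUpper] fun _ : ℂ => (1 : ℝ) :=
    ((hU1.trans hk1).add (hone 1)).congr_left fun k => sub_add_cancel _ _
  have hXM : (fun k => X k - M) =O[atInftyUpper] fun k : ℂ => (1 : ℝ) * ‖k‖ ^ (-1 : ℤ) := by
    have h1 : (fun k => jostValue V k * (M * F) + jostSlope V k * (M * E₂))
        =O[atInftyUpper] fun _ : ℂ => (1 : ℝ) :=
      (isBigO_mul_const _ hU).add (isBigO_mul_const _ ((isBigO_jostSlope hW).trans hk1))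
    have h2 : (fun k : ℂ => (Complex.I * k)⁻¹) =O[atInftyUpper] fun k : ℂ => ‖k‖ ^ (-1 : ℤ) :=
      IsBigO.of_bound 1 (Eventually.of_forall fun k => by simp)
    have h3 := (h2.smul h1).congr_right (g₂ := fun k : ℂ => (1 : ℝ) * ‖k‖ ^ (-1 : ℤ))
      fun k => by rw [smul_eq_mul, mul_comm]
    have h4 := (isBigO_mul_const M hU1).congr_right (g₂ := fun k : ℂ => (1 : ℝ) * ‖k‖ ^ (-1 : ℤ))
      fun k => (one_mul _).symm
    refine (h4.add h3).congr_left fun k => ?_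
    have h5 : jostValue V k * M = jostValue V k * (M * E₁) + jostValue V k * (M * E₂) := by
      rw [← mul_add, ← mul_add, hE, mul_one]
    simp only [X, sub_mul, one_mul, mul_add, add_mul, mul_smul_comm, smul_mul_assoc, smul_add,
      mul_assoc]
    rw [h5]
    abel
  have hX : X =O[atInftyUpper] fun _ : ℂ => (1 : ℝ) :=
    ((hXM.trans (by simpa using hk1)).add (hone M)).congr_left fun k => sub_add_cancel _ _
  have hdet := isBigO_det_sub_det hX (hone M) hXM
  refine ⟨M.det * (∏ j, s j) * T.det, mul_ne_zero (mul_ne_zero hM hs) hT, ?_⟩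
  have hkp : (fun k : ℂ => (∏ j, s j) * T.det * k ^ p) =O[atInftyUpper]
      fun k : ℂ => ‖k‖ ^ (p : ℤ) :=
    IsBigO.const_mul_left (IsBigO.of_bound 1 (Eventually.of_forall fun k => by simp)) _
  refine (hdet.mul hkp).congr' ?_ ?_
  · filter_upwards [eventually_atInftyUpper 1] with k hk
    rw [hJ k hk.2 (norm_pos_iff.1 (by linarith [hk.1])), Matrix.det_mul (X k * D k) T,
      Matrix.det_mul (X k), hD]
    ring
  · filter_upwards [eventually_atInftyUpper 1] with k hk
    have hk0 : ‖k‖ ≠ 0 := by linarith [hk.1]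
    rw [one_pow, one_mul, ← zpow_add₀ hk0, neg_add_eq_sub]

/-! ### Comparison of the coefficients -/

/-- A monomial of lower order than its own degree is zero. -/
theorem eq_zero_of_isBigO_zpow {c : ℂ} {a : ℤ}
    (h : (fun k : ℂ => c * k ^ a) =O[atInftyUpper] fun k : ℂ => ‖k‖ ^ (a - 1)) : c = 0 := by
  have h1 : (fun k : ℂ => k ^ (-a)) =O[atInftyUpper] fun k : ℂ => ‖k‖ ^ (-a) :=
    IsBigO.of_bound 1 (Eventually.of_forall fun k => by simp)
  have hk : ∀ᶠ k in atInftyUpper, ‖k‖ ≠ 0 :=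
    (eventually_atInftyUpper 1).mono fun k hk => by linarith [hk.1]
  have h2 : (fun _ : ℂ => c) =O[atInftyUpper] fun k : ℂ => ‖k‖ ^ (-1 : ℤ) := by
    refine (h.mul h1).congr' (hk.mono fun k hk => ?_) (hk.mono fun k hk => ?_)
    · change c * k ^ a * k ^ (-a) = c
      rw [mul_assoc, ← zpow_add₀ (norm_ne_zero_iff.1 hk), add_neg_cancel, zpow_zero, mul_one]
    · change ‖k‖ ^ (a - 1) * ‖k‖ ^ (-a) = ‖k‖ ^ (-1 : ℤ)
      rw [← zpow_add₀ hk]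
      congr 1
      ring
  have h3 : Tendsto (fun k : ℂ => ‖k‖ ^ (-1 : ℤ)) atInftyUpper (𝓝 0) := by
    simp only [zpow_neg_one]
    exact (tendsto_inv_atTop_zero.comp tendsto_norm_cobounded_atTop).mono_left inf_le_left
  exact tendsto_nhds_unique tendsto_const_nhds (h2.trans_tendsto h3)

theorem isBigO_of_leading {g : ℂ → ℂ} {c : ℂ} {p : ℕ}
    (h : (fun k => g k - c * k ^ p) =O[atInftyUpper] fun k : ℂ => ‖k‖ ^ ((p : ℤ) - 1)) :
    g =O[atInftyUpper] fun k : ℂ => ‖k‖ ^ (p : ℤ) := by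
  have h1 : (fun k : ℂ => c * k ^ p) =O[atInftyUpper] fun k : ℂ => ‖k‖ ^ (p : ℤ) :=
    IsBigO.const_mul_left (IsBigO.of_bound 1 (Eventually.of_forall fun k => by simp)) _
  exact ((h.trans (isBigO_zpow_of_le (by omega))).add h1).congr_left fun k => sub_add_cancel _ _

theorem dCoeff_eq_zero_of_lt_neg {l : ℤ} (hl : l < -(n : ℤ)) : dCoeff V A B l = 0 := by
  have : indexTuples n l = ∅ := Finset.eq_empty_of_forall_notMem fun t ht => by
    obtain ⟨h1, h2⟩ := (mem_indexTuples n l t).1 ht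
    have := Finset.sum_le_sum fun i (_ : i ∈ Finset.univ) => h1 i
    simp only [Finset.sum_const, Finset.card_univ, Fintype.card_fin, smul_neg, nsmul_eq_mul,
      mul_one] at this
    omega
  rw [dCoeff_eq_sum_tupleTerm, this, Finset.sum_empty]

theorem two_I_mul_zpow (k : ℂ) (a : ℤ) :
    (2 * Complex.I * k) ^ a = (2 * Complex.I) ^ a * k ^ a := mul_zpow _ _ _

theorem two_I_zpow_ne_zero (a : ℤ) : (2 * Complex.I : ℂ) ^ a ≠ 0 :=
  zpow_ne_zero _ (by simp)

/-- Coefficients of powers higher than the order of growth of `det J(k)` vanish. -/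
theorem dCoeff_eq_zero {r : ℝ} (hW : IsExtension r V W) {p : ℕ}
    (hp : (fun k => (jostMatrix V A B k).det) =O[atInftyUpper] fun k : ℂ => ‖k‖ ^ (p : ℤ)) (l : ℤ)
    (hl : l < -(p : ℤ)) : dCoeff V A B l = 0 := by
  have key : ∀ m : ℕ, ∀ l : ℤ, l < -(n : ℤ) + m → l < -(p : ℤ) → dCoeff V A B l = 0 := by
    intro m
    induction m with
    | zero => exact fun l hl _ => dCoeff_eq_zero_of_lt_neg (by simpa using hl)
    | succ m ih =>
      intro l hl hlp
      rcases lt_or_ge l (-(n : ℤ) + m) with h | h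
      · exact ih l h hlp
      have hlm : l = -(n : ℤ) + m := by push_cast at hl; omega
      have h1 := isBigO_det_jostMatrix_sub (A := A) (B := B) hW l
      have h2 := (hp.trans (isBigO_zpow_of_le (b := -(l + 1)) (by omega))).sub h1
      have h3 : (dCoeff V A B l * (2 * Complex.I) ^ (-l)) = 0 := by
        refine eq_zero_of_isBigO_zpow (a := -l) ?_
        rw [show -l - 1 = -(l + 1) by ring]
        refine h2.congr_left fun k => ?_
        rw [sub_sub_cancel, Finset.sum_eq_single_of_mem l (by simp [hlm]), two_I_mul_zpow,
          mul_assoc]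
        intro l' hl' hne
        have := Finset.mem_Icc.1 hl'
        rw [ih l' (by omega) (by omega), zero_mul]
      exact (mul_eq_zero.1 h3).resolve_right (two_I_zpow_ne_zero _)
  exact key (l + n + 1).toNat l (by have := Int.self_le_toNat (l + n + 1); omega) hl

theorem sum_Icc_dCoeff_eq {p : ℕ} (hpn : p ≤ n)
    (h0 : ∀ l : ℤ, l < -(p : ℤ) → dCoeff V A B l = 0) (N : ℤ) (g : ℤ → ℂ) :
    ∑ l ∈ Finset.Icc (-(p : ℤ)) N, dCoeff V A B l * g l
      = ∑ l ∈ Finset.Icc (-(n : ℤ)) N, dCoeff V A B l * g l := by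
  refine Finset.sum_subset (Finset.Icc_subset_Icc_left (by omega)) fun l hl hl' => ?_
  rw [Finset.mem_Icc] at hl hl'
  rw [h0 l (by omega), zero_mul]

end Leading

end MatrixSchrodinger

theorem lemma3p3 (n : ℕ) (V : ℝ → Matrix (Fin n) (Fin n) ℂ) (hV : IsAdmissiblePotential V)
    (A B : Matrix (Fin n) (Fin n) ℂ) (hAB : IsBoundaryPair A B) :
    -- the Jost solution and the regular solution exist and are unique, and the Wronskian that
    -- defines the Jost matrix does not depend on `x`
    (∀ k : ℂ, 0 ≤ k.im → k ≠ 0 →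
      IsJostSolution V k (jostSolution V k) ∧
      ∀ g, IsJostSolution V k g → Set.EqOn g (jostSolution V k) (Set.Ici 0)) ∧
    (∀ k : ℂ,
      IsRegularSolution V A B k (regularSolution V A B k) ∧
      ∀ g, IsRegularSolution V A B k g → Set.EqOn g (regularSolution V A B k) (Set.Ici 0)) ∧
    (∀ k : ℂ, 0 ≤ k.im → k ≠ 0 → ∀ x : ℝ, 0 ≤ x → jostWronskian V A B k x = jostMatrix V A B k) ∧
    -- the functions `b_l` are well defined
    (∀ l : ℕ, ContDiffOn ℝ ∞ (bCoeff V l) (Set.Ici 0) ∧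
      MeasureTheory.IntegrableOn (fun y => V y * bCoeff V l y) (Set.Ioi 0)) ∧
    -- the boundary matrices have a diagonal representation
    (∃ (θ : Fin n → ℝ) (M T₁ T₂ : Matrix (Fin n) (Fin n) ℂ),
      IsDiagonalRepresentation A B θ M T₁ T₂) ∧
    -- the asymptotic expansion of `det J(k)` and its leading coefficient
    (∀ (θ : Fin n → ℝ) (M T₁ T₂ : Matrix (Fin n) (Fin n) ℂ),
      IsDiagonalRepresentation A B θ M T₁ T₂ →
      (∀ N : ℤ,
        (fun k : ℂ => (jostMatrix V A B k).det -
            ∑ l ∈ Finset.Icc (-((numMixed θ + numNeumann θ : ℕ) : ℤ)) N,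
              dCoeff V A B l * (1 / (2 * Complex.I * k) ^ l))
          =O[atInftyUpper] (fun k : ℂ => ‖k‖ ^ (-(N + 1)))) ∧
      (∀ l : ℤ, l < -((numMixed θ + numNeumann θ : ℕ) : ℤ) → dCoeff V A B l = 0) ∧
      ∃ c₂ : ℂ, c₂ ≠ 0 ∧
        (fun k : ℂ => (jostMatrix V A B k).det / (c₂ * k ^ (numMixed θ + numNeumann θ)) - 1)
          =O[atInftyUpper] (fun k : ℂ => k⁻¹) ∧
        dCoeff V A B (-((numMixed θ + numNeumann θ : ℕ) : ℤ)) =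
          c₂ / (2 * Complex.I) ^ (numMixed θ + numNeumann θ)) := by
  obtain ⟨r, W, hW⟩ := hV.exists_isExtension
  refine ⟨fun k hk hk0 => existsUnique_jostSolution hW hk hk0,
    fun k => existsUnique_regularSolution hW A B k,
    fun k hk hk0 x hx => jostWronskian_eq_jostMatrix hV hW hk hk0 hx,
    bCoeff_smooth_integrable hW, hAB.exists_isDiagonalRepresentation, ?_⟩
  intro θ M T₁ T₂ hrep
  obtain ⟨c, hc, hlead⟩ := exists_det_jostMatrix_leading hW hrep
  have hpn := numMixed_add_numNeumann_le θ
  set p := numMixed θ + numNeumann θ with hp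
  have h0 := dCoeff_eq_zero hW (isBigO_of_leading hlead)
  have hexp : ∀ N : ℤ, (fun k : ℂ => (jostMatrix V A B k).det -
      ∑ l ∈ Finset.Icc (-(p : ℤ)) N, dCoeff V A B l * (1 / (2 * Complex.I * k) ^ l))
      =O[atInftyUpper] (fun k : ℂ => ‖k‖ ^ (-(N + 1))) := fun N => by
    refine (isBigO_det_jostMatrix_sub (A := A) (B := B) hW N).congr_left fun k => ?_
    simp only [sum_Icc_dCoeff_eq hpn h0, one_div, zpow_neg]
  refine ⟨hexp, h0, c, hc, ?_, ?_⟩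
  · have h1 : (fun k : ℂ => (c * k ^ p)⁻¹) =O[atInftyUpper] fun k : ℂ => ‖k‖ ^ (-(p : ℤ)) :=
      IsBigO.of_bound ‖c⁻¹‖ (Eventually.of_forall fun k => by simp [mul_comm])
    refine ((hlead.mul h1).congr' ?_ ?_).of_norm_right
    · filter_upwards [eventually_atInftyUpper 1] with k hk
      have hk0 : k ≠ 0 := norm_pos_iff.1 (by linarith [hk.1])
      have : c * k ^ p ≠ 0 := mul_ne_zero hc (pow_ne_zero _ hk0)
      rw [sub_mul, mul_inv_cancel₀ this, div_eq_mul_inv]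
    · filter_upwards [eventually_atInftyUpper 1] with k hk
      have hk0 : ‖k‖ ≠ 0 := by linarith [hk.1]
      rw [← zpow_add₀ hk0, show (p : ℤ) - 1 + -(p : ℤ) = -1 by ring, zpow_neg_one, norm_inv]
  · have h1 := hexp (-(p : ℤ))
    rw [show -(-(p : ℤ) + 1) = (p : ℤ) - 1 by ring] at h1
    have h2 : dCoeff V A B (-(p : ℤ)) * (2 * Complex.I) ^ p - c = 0 := by
      refine eq_zero_of_isBigO_zpow (a := p) ((hlead.sub h1).congr_left fun k => ?_)
      rw [Finset.Icc_self, Finset.sum_singleton, one_div, ← zpow_neg, neg_neg, zpow_natCast,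
        zpow_natCast, mul_pow]
      ring
    rw [eq_div_iff (pow_ne_zero _ (by simp)), sub_eq_zero.1 h2]
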